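/- Let $G=(V,E)$ be a finite simple undirected graph (the seat graph) with $n=|V|\ge 1$, let $A$ be a set of $n$ agents, and for each $p\in A$ let $f_p\colon A\setminus\{p\}\to\mathbb{R}$ be the preference of $p$. An arrangement is a bijection $\pi\colon A\to V$. The utility of $p$ under $\pi$ is $U_p(\pi)=\sum_{v\in N_G(\pi(p))} f_p(\pi^{-1}(v))$, and the social welfare of $\pi$ is $\mathrm{sw}(\pi)=\sum_{p\in A}U_p(\pi)$. An arrangement $\pi^*$ is maximum if $\mathrm{sw}(\pi^*)\ge \mathrm{sw}(\pi)$ for every arrangement $\pi$. The problem Maximum Welfare Arrangement asks, given $G$, $A$ and $(f_p)_{p\in A}$, to find a maximum arrangement. Theorem. Maximum Welfare Arrangement can be solved in time $O(n^{\gamma}\,\gamma!\,(n-\gamma)^{3})$, where $\gamma$ is the vertex cover number of $G$, that is, the size of a minimum vertex cover of $G$. Precisely: there are a single program for a unit-cost random access machine and a constant $C$ such that on every instance with $n\ge 1$ the program halts after at most $C\,n^{\gamma}\,\gamma!\,(n-\gamma)^{3}$ steps and outputs a maximum arrangement. The machine has registers and arrays for natural numbers and for real numbers. In one step it performs an access to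 a register or an array entry, an addition, a (for natural numbers truncated) subtraction, a comparison, a Boolean operation, or a control step. Agents and vertices are numbered $0,\dots,n-1$; the input consists of $n$, the adjacency matrix of $G$ and the matrix of the preferences ($\gamma$ is not part of the input). -/

import Mathlib

namespace SeatArrangement

/-! ### Arrangements and social welfare -/

section Model

variable {A V : Type*}

/-- An arrangement of the agents `A` in a seat graph on `V` is a bijection from `A` to `V`. -/
abbrev Arrangement (A V : Type*) := A ≃ V

open Classical in
/-- The utility of agent `p`: the sum of `f p q` over the agents `q` seated next to `p`.
Here `f p q` is the preference of `p` for `q`; as a simple graph has no loops, the diagonal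
values `f p p` never occur, so `f p` is in effect a function on the agents other than `p`. -/
noncomputable def utility [Fintype V] (G : SimpleGraph V) (f : A → A → ℝ)
    (π : Arrangement A V) (p : A) : ℝ :=
  ∑ v ∈ Finset.univ.filter (fun v => G.Adj (π p) v), f p (π.symm v)

/-- The social welfare: the sum of the utilities of all agents. -/
noncomputable def socialWelfare [Fintype A] [Fintype V] (G : SimpleGraph V) (f : A → A → ℝ)
    (π : Arrangement A V) : ℝ :=
  ∑ p, utility G f π p

/-- A maximum arrangement: no arrangement has larger social welfare. -/
def IsMaximum [Fintype A] [Fintype V] (G : SimpleGraph V) (f : A → A → ℝ)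
    (π : Arrangement A V) : Prop :=
  ∀ π' : Arrangement A V, socialWelfare G f π' ≤ socialWelfare G f π

end Model

/-! ### A random access machine with real numbers, and its running time

Programs are structured programs over registers and (one-dimensional, unbounded) arrays that hold
natural numbers or real numbers. Registers and arrays are named by numerals that are fixed in the
program, so each program uses finitely many of them; array indices are computed at run time.
The operations on naturals are constants, addition, truncated subtraction and comparison; those on
reals are the constant zero, addition, subtraction and comparison. There is no multiplication, no
rounding, and no passage from reals to naturals other than comparison. Every evaluation of an
operation, of a register or array access, of a test, and every command costs one step. -/

/-- A memory state: registers and arrays for naturals (`nReg`, `nArr`) and reals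
(`rReg`, `rArr`). -/
@[ext]
structure State where
  nReg : ℕ → ℕ
  rReg : ℕ → ℝ
  nArr : ℕ → ℕ → ℕ
  rArr : ℕ → ℕ → ℝ

/-- Expressions for natural numbers; `get a i` is the entry of array `a` at index `i`. -/
inductive NExp where
  | const (c : ℕ)
  | reg (x : ℕ)
  | get (a : ℕ) (i : NExp)
  | add (e₁ e₂ : NExp)
  | sub (e₁ e₂ : NExp)

/-- Expressions for real numbers. -/
inductive RExp where
  | zero
  | reg (x : ℕ)
  | get (a : ℕ) (i : NExp)
  | add (e₁ e₂ : RExp)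
  | sub (e₁ e₂ : RExp)

/-- Tests. -/
inductive BExp where
  | nle (e₁ e₂ : NExp)
  | rle (e₁ e₂ : RExp)
  | not (b : BExp)
  | and (b₁ b₂ : BExp)

/-- Programs. -/
inductive Prog where
  | skip
  | nSet (x : ℕ) (e : NExp)
  | rSet (x : ℕ) (e : RExp)
  | nPut (a : ℕ) (i : NExp) (e : NExp)
  | rPut (a : ℕ) (i : NExp) (e : RExp)
  | seq (c₁ c₂ : Prog)
  | ite (b : BExp) (c₁ c₂ : Prog)
  | while (b : BExp) (c : Prog)

/-- The value of an expression for naturals. -/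
def NExp.eval (s : State) : NExp → ℕ
  | .const c => c
  | .reg x => s.nReg x
  | .get a i => s.nArr a (i.eval s)
  | .add e₁ e₂ => e₁.eval s + e₂.eval s
  | .sub e₁ e₂ => e₁.eval s - e₂.eval s

/-- The number of steps for evaluating an expression for naturals. -/
def NExp.cost : NExp → ℕ
  | .const _ => 1
  | .reg _ => 1
  | .get _ i => i.cost + 1
  | .add e₁ e₂ => e₁.cost + e₂.cost + 1
  | .sub e₁ e₂ => e₁.cost + e₂.cost + 1

/-- The value of an expression for reals. -/
noncomputable def RExp.eval (s : State) : RExp → ℝ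
  | .zero => 0
  | .reg x => s.rReg x
  | .get a i => s.rArr a (i.eval s)
  | .add e₁ e₂ => e₁.eval s + e₂.eval s
  | .sub e₁ e₂ => e₁.eval s - e₂.eval s

/-- The number of steps for evaluating an expression for reals. -/
def RExp.cost : RExp → ℕ
  | .zero => 1
  | .reg _ => 1
  | .get _ i => i.cost + 1
  | .add e₁ e₂ => e₁.cost + e₂.cost + 1
  | .sub e₁ e₂ => e₁.cost + e₂.cost + 1

/-- The truth value of a test. -/
def BExp.Holds (s : State) : BExp → Prop
  | .nle e₁ e₂ => e₁.eval s ≤ e₂.eval s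
  | .rle e₁ e₂ => e₁.eval s ≤ e₂.eval s
  | .not b => ¬ b.Holds s
  | .and b₁ b₂ => b₁.Holds s ∧ b₂.Holds s

/-- The number of steps for evaluating a test. -/
def BExp.cost : BExp → ℕ
  | .nle e₁ e₂ => e₁.cost + e₂.cost + 1
  | .rle e₁ e₂ => e₁.cost + e₂.cost + 1
  | .not b => b.cost + 1
  | .and b₁ b₂ => b₁.cost + b₂.cost + 1

/-- Write `k` into register `x` for naturals. -/
def State.setN (s : State) (x k : ℕ) : State :=
  { s with nReg := Function.update s.nReg x k }

/-- Write `r` into register `x` for reals. -/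
def State.setR (s : State) (x : ℕ) (r : ℝ) : State :=
  { s with rReg := Function.update s.rReg x r }

/-- Write `k` into the array `a` for naturals at index `i`. -/
def State.putN (s : State) (a i k : ℕ) : State :=
  { s with nArr := Function.update s.nArr a (Function.update (s.nArr a) i k) }

/-- Write `r` into the array `a` for reals at index `i`. -/
def State.putR (s : State) (a i : ℕ) (r : ℝ) : State :=
  { s with rArr := Function.update s.rArr a (Function.update (s.rArr a) i r) }

/-- `Exec c s t s'`: the program `c`, started in state `s`, halts after exactly `t` steps in
state `s'`. -/
inductive Exec : Prog → State → ℕ → State → Prop where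
  | skip (s : State) : Exec .skip s 1 s
  | nSet (s : State) (x : ℕ) (e : NExp) :
      Exec (.nSet x e) s (e.cost + 1) (s.setN x (e.eval s))
  | rSet (s : State) (x : ℕ) (e : RExp) :
      Exec (.rSet x e) s (e.cost + 1) (s.setR x (e.eval s))
  | nPut (s : State) (a : ℕ) (i e : NExp) :
      Exec (.nPut a i e) s (i.cost + e.cost + 1) (s.putN a (i.eval s) (e.eval s))
  | rPut (s : State) (a : ℕ) (i : NExp) (e : RExp) :
      Exec (.rPut a i e) s (i.cost + e.cost + 1) (s.putR a (i.eval s) (e.eval s))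
  | seq {c₁ c₂ : Prog} {s₁ s₂ s₃ : State} {t₁ t₂ : ℕ} :
      Exec c₁ s₁ t₁ s₂ → Exec c₂ s₂ t₂ s₃ → Exec (.seq c₁ c₂) s₁ (t₁ + t₂ + 1) s₃
  | iteTrue {b : BExp} {c₁ c₂ : Prog} {s s' : State} {t : ℕ} :
      b.Holds s → Exec c₁ s t s' → Exec (.ite b c₁ c₂) s (b.cost + t + 1) s'
  | iteFalse {b : BExp} {c₁ c₂ : Prog} {s s' : State} {t : ℕ} :
      ¬ b.Holds s → Exec c₂ s t s' → Exec (.ite b c₁ c₂) s (b.cost + t + 1) s'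
  | whileFalse {b : BExp} {c : Prog} {s : State} :
      ¬ b.Holds s → Exec (.while b c) s (b.cost + 1) s
  | whileTrue {b : BExp} {c : Prog} {s₁ s₂ s₃ : State} {t₁ t₂ : ℕ} :
      b.Holds s₁ → Exec c s₁ t₁ s₂ → Exec (.while b c) s₂ t₂ s₃ →
      Exec (.while b c) s₁ (b.cost + t₁ + t₂ + 1) s₃

/-! ### Input and output -/

/-- The row-major listing of an `n × n` matrix: the entry `M i j` stands at index `i * n + j`;
all indices from `n * n` on hold zero. -/
def rowMajor {α : Type*} [Zero α] {n : ℕ} (M : Fin n → Fin n → α) (k : ℕ) : α :=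
  if h : k < n * n then
    M ⟨k / n, Nat.div_lt_of_lt_mul h⟩ ⟨k % n, Nat.mod_lt k (Nat.pos_of_lt_mul_left h)⟩
  else 0

open Classical in
/-- The start state for the input consisting of a seat graph `G` and preferences `f`, where agents
and vertices are numbered from `0` to `n - 1`: register 0 for naturals holds `n`, array 0 for
naturals holds the adjacency matrix of `G`, array 0 for reals holds the matrix of the preferences,
and everything else is zero. -/
noncomputable def inputState {n : ℕ} (G : SimpleGraph (Fin n)) (f : Fin n → Fin n → ℝ) : State where
  nReg := fun x => if x = 0 then n else 0
  rReg := fun _ => 0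
  nArr := fun a => if a = 0 then rowMajor (fun u v => if G.Adj u v then 1 else 0) else fun _ => 0
  rArr := fun a => if a = 0 then rowMajor f else fun _ => 0

/-- The state `s` holds the arrangement `π` as output: entry `p` of array 1 for naturals is the
vertex at which `π` seats agent `p`. -/
def Outputs {n : ℕ} (s : State) (π : Arrangement (Fin n) (Fin n)) : Prop :=
  ∀ p : Fin n, s.nArr 1 p = π p

end SeatArrangement

namespace SeatArrangement

/-! ### A calculus for total correctness with time bounds -/

/-! Fix a vertex cover and the agents that sit on it. No edge joins two seats outside the cover, so
the welfare is a constant plus a sum, over the outside seats, of a weight that depends only on the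
seat and its agent (`welfare_eq`). Seating the remaining agents is therefore an assignment problem,
which the Hungarian method solves in O(n³) steps. Trying all n^γ tuples of agents on a minimum
cover, and rejecting those with repetitions, reaches every arrangement's restriction to the cover,
so the best result found is a maximum arrangement (`run_tryAll`).

The number γ is not part of the input. A minimum cover is found by testing tuples of seats, shorter
ones before longer ones. At most (γ+1)·n^γ tuples precede or equal a known cover of size γ, and each
test costs O(n²) (`run_findCover`).

Altogether the time is O(n^γ·((γ+1)·n² + n³)). Since n ≥ 1 gives γ < n, one has n ≤ (γ+1)(n-γ),
hence n³ ≤ (γ+1)³(n-γ)³; the factor γ! of the claim serves only to absorb (γ+1)³ (`time_bound`).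

The Hungarian method keeps feasible potentials `u`, `y` and a partial seating that is tight for
them. A complete tight seating is optimal by linear programming duality (`Partial.optimal`). One
more agent is seated per round, by growing an alternating tree (`Tree.update`, `Tree.grow`) until it
reaches a free seat and then shifting agents along the tree path (`Augment.step`). Each column
outside the tree keeps its least slack as a label, so adding a column costs O(n) and a round O(n²).

Programs are verified with the judgement `Run`, which combines termination, a time bound and a
postcondition. The numerical constants are crude and carry no meaning beyond making the bounds add
up. -/

/-- The program `c`, started in `s`, halts within `T` steps in a state that satisfies `Q`. -/
def Run (c : Prog) (s : State) (T : ℕ) (Q : State → Prop) : Prop :=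
  ∃ t s', Exec c s t s' ∧ t ≤ T ∧ Q s'

theorem Run.mono {c : Prog} {s : State} {T T' : ℕ} {Q Q' : State → Prop} (h : Run c s T Q)
    (hT : T ≤ T') (hQ : ∀ s', Q s' → Q' s') : Run c s T' Q' := by
  obtain ⟨t, s', he, ht, hq⟩ := h
  exact ⟨t, s', he, ht.trans hT, hQ _ hq⟩

theorem Run.seq {c d : Prog} {s : State} {T₁ T₂ T : ℕ} {R Q : State → Prop}
    (h₁ : Run c s T₁ R) (h₂ : ∀ s', R s' → Run d s' T₂ Q) (hT : T₁ + T₂ + 1 ≤ T) :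
    Run (.seq c d) s T Q := by
  obtain ⟨t₁, s₁, he₁, ht₁, hr⟩ := h₁
  obtain ⟨t₂, s₂, he₂, ht₂, hq⟩ := h₂ _ hr
  exact ⟨_, s₂, .seq he₁ he₂, by omega, hq⟩

theorem Run.ite {b : BExp} {c d : Prog} {s : State} {T T' : ℕ} {Q : State → Prop}
    (h₁ : b.Holds s → Run c s T Q) (h₂ : ¬ b.Holds s → Run d s T Q)
    (hT : b.cost + T + 1 ≤ T') : Run (.ite b c d) s T' Q := by
  by_cases hb : b.Holds s
  · obtain ⟨t, s', he, ht, hq⟩ := h₁ hb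
    exact ⟨_, s', .iteTrue hb he, by omega, hq⟩
  · obtain ⟨t, s', he, ht, hq⟩ := h₂ hb
    exact ⟨_, s', .iteFalse hb he, by omega, hq⟩

/-! #### Straight-line programs -/

/-- The program has no loops. -/
def Prog.loopFree : Prog → Bool
  | .seq c d => c.loopFree && d.loopFree
  | .ite _ c d => c.loopFree && d.loopFree
  | .while _ _ => false
  | _ => true

/-- A bound for the number of steps of a program without loops. -/
def Prog.bound : Prog → ℕ
  | .skip => 1
  | .nSet _ e => e.cost + 1
  | .rSet _ e => e.cost + 1
  | .nPut _ i e => i.cost + e.cost + 1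
  | .rPut _ i e => i.cost + e.cost + 1
  | .seq c d => c.bound + d.bound + 1
  | .ite b c d => b.cost + max c.bound d.bound + 1
  | .while _ _ => 0

open Classical in
/-- The final state of a program without loops. -/
noncomputable def Prog.run : Prog → State → State
  | .skip, s => s
  | .nSet x e, s => s.setN x (e.eval s)
  | .rSet x e, s => s.setR x (e.eval s)
  | .nPut a i e, s => s.putN a (i.eval s) (e.eval s)
  | .rPut a i e, s => s.putR a (i.eval s) (e.eval s)
  | .seq c d, s => d.run (c.run s)
  | .ite b c d, s => if b.Holds s then c.run s else d.run s
  | .while _ _, s => s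

/-- Loop-free code has a computable cost bound and an explicit final state. For concrete code the
side conditions thus close by `rfl` or `decide`, and the postcondition is reached by simplification.
-/
theorem Prog.exec_run {c : Prog} (hl : c.loopFree = true) (s : State) :
    ∃ t ≤ c.bound, Exec c s t (c.run s) := by
  induction c generalizing s with
  | skip => exact ⟨_, le_rfl, .skip s⟩
  | nSet x e => exact ⟨_, le_rfl, .nSet s x e⟩
  | rSet x e => exact ⟨_, le_rfl, .rSet s x e⟩
  | nPut a i e => exact ⟨_, le_rfl, .nPut s a i e⟩
  | rPut a i e => exact ⟨_, le_rfl, .rPut s a i e⟩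
  | seq c d hc hd =>
    simp only [loopFree, Bool.and_eq_true] at hl
    obtain ⟨t₁, h₁, e₁⟩ := hc hl.1 s
    obtain ⟨t₂, h₂, e₂⟩ := hd hl.2 (c.run s)
    exact ⟨_, by simp only [bound]; omega, .seq e₁ e₂⟩
  | ite b c d hc hd =>
    simp only [loopFree, Bool.and_eq_true] at hl
    by_cases hb : b.Holds s
    · obtain ⟨t, h, e⟩ := hc hl.1 s
      refine ⟨b.cost + t + 1, by simp only [bound]; omega, ?_⟩
      simpa only [run, if_pos hb] using Exec.iteTrue hb e
    · obtain ⟨t, h, e⟩ := hd hl.2 s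
      refine ⟨b.cost + t + 1, by simp only [bound]; omega, ?_⟩
      simpa only [run, if_neg hb] using Exec.iteFalse hb e
  | _ => simp [loopFree] at hl

theorem Run.straight {c : Prog} {s : State} {T : ℕ} {Q : State → Prop}
    (hl : c.loopFree = true) (hT : c.bound ≤ T) (hQ : Q (c.run s)) : Run c s T Q := by
  obtain ⟨t, ht, he⟩ := Prog.exec_run hl s
  exact ⟨t, _, he, ht.trans hT, hQ⟩

/-! ### Reading the memory after a write -/

section Simp

variable (s : State) (x y a b i k : ℕ) (r : ℝ)

@[simp] theorem State.setN_nReg :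
    (s.setN x k).nReg y = if y = x then k else s.nReg y := by
  simp [State.setN, Function.update_apply]

@[simp] theorem State.setN_rReg : (s.setN x k).rReg = s.rReg := rfl
@[simp] theorem State.setN_nArr : (s.setN x k).nArr = s.nArr := rfl
@[simp] theorem State.setN_rArr : (s.setN x k).rArr = s.rArr := rfl

@[simp] theorem State.setR_rReg :
    (s.setR x r).rReg y = if y = x then r else s.rReg y := by
  simp [State.setR, Function.update_apply]

@[simp] theorem State.setR_nReg : (s.setR x r).nReg = s.nReg := rfl
@[simp] theorem State.setR_nArr : (s.setR x r).nArr = s.nArr := rfl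
@[simp] theorem State.setR_rArr : (s.setR x r).rArr = s.rArr := rfl

@[simp] theorem State.putN_nArr :
    (s.putN a i k).nArr b = if b = a then Function.update (s.nArr a) i k else s.nArr b := by
  by_cases h : b = a
  · subst h; simp [State.putN]
  · simp [State.putN, h]

@[simp] theorem State.putN_nReg : (s.putN a i k).nReg = s.nReg := rfl
@[simp] theorem State.putN_rReg : (s.putN a i k).rReg = s.rReg := rfl
@[simp] theorem State.putN_rArr : (s.putN a i k).rArr = s.rArr := rfl

@[simp] theorem State.putR_rArr :
    (s.putR a i r).rArr b = if b = a then Function.update (s.rArr a) i r else s.rArr b := by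
  by_cases h : b = a
  · subst h; simp [State.putR]
  · simp [State.putR, h]

@[simp] theorem State.putR_nReg : (s.putR a i r).nReg = s.nReg := rfl
@[simp] theorem State.putR_rReg : (s.putR a i r).rReg = s.rReg := rfl
@[simp] theorem State.putR_nArr : (s.putR a i r).nArr = s.nArr := rfl

end Simp

attribute [simp] NExp.eval RExp.eval BExp.Holds Prog.run

/-! #### Frames -/

/-- The program may write into register `x` for naturals. -/
def Prog.setsN (x : ℕ) : Prog → Bool
  | .nSet y _ => x == y
  | .seq c d => c.setsN x || d.setsN x
  | .ite _ c d => c.setsN x || d.setsN x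
  | .while _ c => c.setsN x
  | _ => false

/-- The program may write into register `x` for reals. -/
def Prog.setsR (x : ℕ) : Prog → Bool
  | .rSet y _ => x == y
  | .seq c d => c.setsR x || d.setsR x
  | .ite _ c d => c.setsR x || d.setsR x
  | .while _ c => c.setsR x
  | _ => false

/-- The program may write into the array `a` for naturals. -/
def Prog.putsN (a : ℕ) : Prog → Bool
  | .nPut b _ _ => a == b
  | .seq c d => c.putsN a || d.putsN a
  | .ite _ c d => c.putsN a || d.putsN a
  | .while _ c => c.putsN a
  | _ => false

/-- The program may write into the array `a` for reals. -/
def Prog.putsR (a : ℕ) : Prog → Bool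
  | .rPut b _ _ => a == b
  | .seq c d => c.putsR a || d.putsR a
  | .ite _ c d => c.putsR a || d.putsR a
  | .while _ c => c.putsR a
  | _ => false

/-- The states `s` and `s'` agree on all registers and arrays into which `c` does not write. -/
structure Frame (c : Prog) (s s' : State) : Prop where
  nReg : ∀ x, c.setsN x = false → s'.nReg x = s.nReg x
  rReg : ∀ x, c.setsR x = false → s'.rReg x = s.rReg x
  nArr : ∀ a, c.putsN a = false → s'.nArr a = s.nArr a
  rArr : ∀ a, c.putsR a = false → s'.rArr a = s.rArr a

theorem Frame.refl (c : Prog) (s : State) : Frame c s s :=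
  ⟨fun _ _ => rfl, fun _ _ => rfl, fun _ _ => rfl, fun _ _ => rfl⟩

theorem Frame.trans {c : Prog} {s₁ s₂ s₃ : State} (h : Frame c s₁ s₂) (h' : Frame c s₂ s₃) :
    Frame c s₁ s₃ :=
  ⟨fun x hx => (h'.nReg x hx).trans (h.nReg x hx), fun x hx => (h'.rReg x hx).trans (h.rReg x hx),
    fun a ha => (h'.nArr a ha).trans (h.nArr a ha), fun a ha => (h'.rArr a ha).trans (h.rArr a ha)⟩

theorem Frame.weaken {c d : Prog} {s s' : State} (h : Frame c s s')
    (hn : ∀ x, d.setsN x = false → c.setsN x = false)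
    (hr : ∀ x, d.setsR x = false → c.setsR x = false)
    (hn' : ∀ x, d.putsN x = false → c.putsN x = false)
    (hr' : ∀ x, d.putsR x = false → c.putsR x = false) : Frame d s s' :=
  ⟨fun x hx => h.nReg x (hn x hx), fun x hx => h.rReg x (hr x hx),
    fun a ha => h.nArr a (hn' a ha), fun a ha => h.rArr a (hr' a ha)⟩

/-- Only assignments that occur in the text of a program can change memory. The write sets are
Boolean functions of the text, so for concrete programs "not written" holds by `rfl`, and loop
invariants need not mention untouched memory. -/
theorem Exec.frame {c : Prog} {s s' : State} {t : ℕ} (h : Exec c s t s') : Frame c s s' := by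
  induction h with
  | skip => exact .refl _ _
  | nSet s x e =>
    refine ⟨fun y hy => ?_, fun _ _ => rfl, fun _ _ => rfl, fun _ _ => rfl⟩
    simp only [Prog.setsN, beq_eq_false_iff_ne] at hy
    simp [hy]
  | rSet s x e =>
    refine ⟨fun _ _ => rfl, fun y hy => ?_, fun _ _ => rfl, fun _ _ => rfl⟩
    simp only [Prog.setsR, beq_eq_false_iff_ne] at hy
    simp [hy]
  | nPut s a i e =>
    refine ⟨fun _ _ => rfl, fun _ _ => rfl, fun y hy => ?_, fun _ _ => rfl⟩
    simp only [Prog.putsN, beq_eq_false_iff_ne] at hy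
    simp [hy]
  | rPut s a i e =>
    refine ⟨fun _ _ => rfl, fun _ _ => rfl, fun _ _ => rfl, fun y hy => ?_⟩
    simp only [Prog.putsR, beq_eq_false_iff_ne] at hy
    simp [hy]
  | seq _ _ h₁ h₂ =>
    exact (h₁.weaken (by simp +contextual [Prog.setsN]) (by simp +contextual [Prog.setsR])
      (by simp +contextual [Prog.putsN]) (by simp +contextual [Prog.putsR])).trans
      (h₂.weaken (by simp +contextual [Prog.setsN]) (by simp +contextual [Prog.setsR])
      (by simp +contextual [Prog.putsN]) (by simp +contextual [Prog.putsR]))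
  | iteTrue _ _ h =>
    exact h.weaken (by simp +contextual [Prog.setsN]) (by simp +contextual [Prog.setsR])
      (by simp +contextual [Prog.putsN]) (by simp +contextual [Prog.putsR])
  | iteFalse _ _ h =>
    exact h.weaken (by simp +contextual [Prog.setsN]) (by simp +contextual [Prog.setsR])
      (by simp +contextual [Prog.putsN]) (by simp +contextual [Prog.putsR])
  | whileFalse => exact .refl _ _
  | whileTrue _ _ _ h₁ h₂ =>
    exact Frame.trans (c := .while _ _)
      (h₁.weaken (fun _ h => h) (fun _ h => h) (fun _ h => h) (fun _ h => h)) h₂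

theorem Run.frame {c : Prog} {s : State} {T : ℕ} {Q : State → Prop} (h : Run c s T Q) :
    Run c s T (fun s' => Q s' ∧ Frame c s s') := by
  obtain ⟨t, s', he, ht, hq⟩ := h
  exact ⟨t, s', he, ht, hq, he.frame⟩

/-! #### Loops -/

/-- The index of the invariant bounds the number of remaining rounds. It has to fall in each round,
by any amount, so strong induction on it gives termination and the time bound together. -/
theorem Run.while {b : BExp} {c : Prog} {T T' K : ℕ} {s₀ : State} (I : ℕ → State → Prop)
    (h₀ : I K s₀)
    (hs : ∀ k s, Frame c s₀ s → I k s → b.Holds s → Run c s T (fun s' => ∃ k' < k, I k' s'))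
    (hT : K * (T + b.cost + 1) + b.cost + 1 ≤ T') :
    Run (.while b c) s₀ T' (fun s => (∃ k, I k s) ∧ ¬ b.Holds s ∧ Frame c s₀ s) := by
  suffices H : ∀ k s, Frame c s₀ s → I k s →
      Run (.while b c) s (k * (T + b.cost + 1) + b.cost + 1)
        (fun s => (∃ k, I k s) ∧ ¬ b.Holds s ∧ Frame c s₀ s) from
    (H K s₀ (.refl _ _) h₀).mono hT fun _ h => h
  intro k
  induction k using Nat.strong_induction_on with
  | _ k ih =>
    intro s hF hI
    by_cases hb : b.Holds s
    · obtain ⟨t, s₁, he, ht, ⟨k', hk', hI'⟩, hF'⟩ := (hs k s hF hI hb).frame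
      obtain ⟨t', s₂, he', ht', hq⟩ := ih k' hk' s₁ (hF.trans hF') hI'
      refine ⟨_, s₂, .whileTrue hb he he', ?_, hq⟩
      have : (k' + 1) * (T + b.cost + 1) ≤ k * (T + b.cost + 1) := Nat.mul_le_mul_right _ hk'
      rw [Nat.succ_mul] at this
      omega
    · exact ⟨_, s, .whileFalse hb, by omega, ⟨k, hI⟩, hb, hF⟩

/-- Run `c` for `x = 0, …, y - 1`, where `x` and `y` are registers for naturals. -/
def Prog.forTo (x y : ℕ) (c : Prog) : Prog :=
  .seq (.nSet x (.const 0))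
    (.while (.not (.nle (.reg y) (.reg x))) (.seq c (.nSet x (.add (.reg x) (.const 1)))))

/-- A round costs T for the body, 4 for the increment, 1 for sequencing, 4 for the test and 1 for
the loop, hence T + 10; initialisation and the failing last test account for the 8. The invariant
after a round is stated for the state in which the counter has already been advanced. -/
theorem Run.forTo {x y : ℕ} {c : Prog} {N T T' : ℕ} {s₀ : State} (I : ℕ → State → Prop)
    (hN : s₀.nReg y = N) (hxy : x ≠ y) (hx : c.setsN x = false) (hy : c.setsN y = false)
    (h₀ : I 0 (s₀.setN x 0))
    (hs : ∀ k < N, ∀ s, Frame (Prog.forTo x y c) s₀ s → s.nReg x = k → I k s →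
      Run c s T (fun s' => I (k + 1) (s'.setN x (k + 1))))
    (hT : N * (T + 10) + 8 ≤ T') :
    Run (Prog.forTo x y c) s₀ T' (fun s => I N s ∧ Frame (Prog.forTo x y c) s₀ s) := by
  have hF₀ : Frame (.seq c (.nSet x (.add (.reg x) (.const 1)))) s₀ (s₀.setN x 0) := by
    refine ⟨fun z hz => ?_, fun _ _ => rfl, fun _ _ => rfl, fun _ _ => rfl⟩
    simp only [Prog.setsN, Bool.or_eq_false_iff, beq_eq_false_iff_ne] at hz
    simp [hz.2]
  refine Run.frame (Run.seq (R := fun s => s = s₀.setN x 0)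
    (T₁ := 2) (T₂ := N * (T + 10) + 5) (.straight rfl le_rfl rfl) ?_ (by omega))
  rintro _ rfl
  refine (Run.while (K := N)
    (T := T + 5) (fun j s => ∃ k, s.nReg x = k ∧ k + j = N ∧ I k s) ⟨0, by simp, by simp, h₀⟩
    ?_ (by
      simp only [BExp.cost, NExp.cost]; ring_nf; omega)).mono le_rfl ?_
  · rintro j s hF ⟨k, hk, hkN, hI⟩ hb
    have hyN : s.nReg y = N := by
      have := hF.nReg y (by simp [Prog.setsN, hy, hxy.symm])
      simpa [hxy.symm, hN] using this
    have hkj : k < N := by simpa [hyN, hk] using hb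
    refine Run.seq (hs k hkj s ?_ hk hI).frame (T₂ := 4) ?_ (by omega)
    · exact (hF₀.trans hF).weaken (by simp [Prog.forTo, Prog.setsN])
        (by simp [Prog.forTo, Prog.setsR]) (by simp [Prog.forTo, Prog.putsN])
        (by simp [Prog.forTo, Prog.putsR])
    · rintro s' ⟨hI', hF'⟩
      refine .straight rfl le_rfl ⟨j - 1, by omega, k + 1, ?_, by omega, ?_⟩
      · simp [hF'.nReg x hx, hk]
      · simpa [hF'.nReg x hx, hk] using hI'
  · rintro s ⟨⟨j, k, hk, hkN, hI⟩, hb, hF⟩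
    have hyN : s.nReg y = N := by
      have := hF.nReg y (by simp [Prog.setsN, hy, hxy.symm])
      simpa [hxy.symm, hN] using this
    have : k = N := by
      have : N ≤ k := by simpa [hyN, hk] using hb
      omega
    exact this ▸ hI

/-! ### The assignment problem: alternating trees and augmentation

Agents and seats are natural numbers below `n`; a partial seating `p` maps a seat to the agent
that sits there, or to `n` if the seat is free. -/

/-- `σ` permutes the numbers below `n`. -/
def Permutes (n : ℕ) (σ : ℕ → ℕ) : Prop :=
  (∀ v < n, σ v < n) ∧ ∀ v < n, ∀ v' < n, σ v = σ v' → v = v'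

theorem Permutes.image_range {n : ℕ} {σ : ℕ → ℕ} (h : Permutes n σ) :
    (Finset.range n).image σ = Finset.range n := by
  apply Finset.eq_of_subset_of_card_le
  · intro q hq
    obtain ⟨v, hv, rfl⟩ := Finset.mem_image.mp hq
    exact Finset.mem_range.mpr (h.1 v (Finset.mem_range.mp hv))
  · rw [Finset.card_image_of_injOn]
    intro v hv v' hv' he
    exact h.2 v (by simpa using hv) v' (by simpa using hv') he

theorem Permutes.surj {n : ℕ} {σ : ℕ → ℕ} (h : Permutes n σ) {q : ℕ} (hq : q < n) :
    ∃ v < n, σ v = q := by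
  have : q ∈ (Finset.range n).image σ := by rw [h.image_range]; simpa using hq
  simpa using this

theorem Permutes.sum_comp {n : ℕ} {σ : ℕ → ℕ} (h : Permutes n σ) (u : ℕ → ℝ) :
    ∑ v ∈ Finset.range n, u (σ v) = ∑ q ∈ Finset.range n, u q := by
  conv_rhs => rw [← h.image_range]
  rw [Finset.sum_image]
  intro v hv v' hv' he
  exact h.2 v (by simpa using hv) v' (by simpa using hv') he

theorem permutes_of_surj {n : ℕ} {σ : ℕ → ℕ} (h : ∀ q < n, ∃ v < n, σ v = q) : Permutes n σ := by
  have hsub : Finset.range n ⊆ (Finset.range n).image σ := fun q hq => by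
    simpa using h q (by simpa using hq)
  have hcard : ((Finset.range n).image σ).card = (Finset.range n).card :=
    le_antisymm Finset.card_image_le (Finset.card_le_card hsub)
  have heq : Finset.range n = (Finset.range n).image σ :=
    Finset.eq_of_subset_of_card_le hsub hcard.le
  refine ⟨fun v hv => ?_, fun v hv v' hv' he => ?_⟩
  · have : σ v ∈ Finset.range n := by
      rw [heq]; exact Finset.mem_image_of_mem _ (by simpa using hv)
    simpa using this
  · exact Finset.card_image_iff.mp hcard (by simpa using hv) (by simpa using hv') he

/-! ### Partial seatings with potentials, and alternating trees -/

section Assignment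

variable {n : ℕ} {w : ℕ → ℕ → ℝ} {A M p₀ : ℕ → ℕ} {i : ℕ} {p : ℕ → ℕ} {u y : ℕ → ℝ}
  {used rows way : ℕ → ℕ} {minv : ℕ → ℝ} {ρ : ℕ → ℕ}

/-- The state of the Hungarian method when the unmarked agents below `i` have been seated on
unmarked seats: `p` is tight for the feasible potentials `u`, `y`; the marked agents (mark `A`)
stay on the marked seats (mark `M`) as prescribed by `p₀`. -/
structure Partial (n : ℕ) (w : ℕ → ℕ → ℝ) (A M p₀ : ℕ → ℕ) (i : ℕ) (p : ℕ → ℕ) (u y : ℕ → ℝ) :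
    Prop where
  feas : ∀ q < n, ∀ v < n, M v = 0 → w q v ≤ u q + y v
  tight : ∀ v < n, M v = 0 → p v < n → u (p v) + y v = w (p v) v
  le : ∀ v < n, p v ≤ n
  inj : ∀ v < n, ∀ v' < n, p v < n → p v = p v' → v = v'
  range : ∀ q < n, (∃ v < n, p v = q) ↔ (A q ≠ 0 ∨ q < i)
  fixed : ∀ v < n, M v ≠ 0 → p v = p₀ v ∧ p₀ v < n

/-- A marked agent already has its seat, so passing over it does not change the set of seated
agents. -/
theorem Partial.skip (h : Partial n w A M p₀ i p u y) (hi : A i ≠ 0) :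
    Partial n w A M p₀ (i + 1) p u y := by
  refine { h with range := fun q hq => (h.range q hq).trans ⟨?_, ?_⟩ }
  · rintro (h | h)
    exacts [.inl h, .inr (by omega)]
  · rintro (h | h)
    · exact .inl h
    · rcases eq_or_ne q i with rfl | hne
      exacts [.inl hi, .inr (by omega)]

/-- Only entries below `n` matter. Entry `n` of the seating array is thus free to hold the root of
the tree. -/
theorem Partial.congr {u' y' : ℕ → ℝ} {p' : ℕ → ℕ} (h : Partial n w A M p₀ i p u y)
    (hp : ∀ v < n, p' v = p v)
    (hu : ∀ q < n, u' q = u q) (hy : ∀ v < n, y' v = y v) : Partial n w A M p₀ i p' u' y' where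
  feas q hq v hv hM := by rw [hu q hq, hy v hv]; exact h.feas q hq v hv hM
  tight v hv hM hpv := by
    rw [hp v hv] at hpv ⊢
    rw [hu _ hpv, hy v hv]; exact h.tight v hv hM hpv
  le v hv := by rw [hp v hv]; exact h.le v hv
  inj v hv v' hv' := by rw [hp v hv, hp v' hv']; exact h.inj v hv v' hv'
  range q hq := by
    rw [← h.range q hq]
    exact exists_congr fun v => and_congr_right fun hv => by rw [hp v hv]
  fixed v hv := by rw [hp v hv]; exact h.fixed v hv

/-- The number of columns of the alternating tree. -/
def treeSize (n : ℕ) (used : ℕ → ℕ) : ℕ := ((Finset.range n).filter (fun v => used v = 1)).card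

theorem treeSize_le : treeSize n used ≤ n :=
  (Finset.card_filter_le _ _).trans (Finset.card_range n).le

theorem treeSize_update {j : ℕ} (hj : j < n) (h : used j ≠ 1) :
    treeSize n (Function.update used j 1) = treeSize n used + 1 := by
  unfold treeSize
  have : (Finset.range n).filter (fun v => Function.update used j 1 v = 1) =
      insert j ((Finset.range n).filter (fun v => used v = 1)) := by
    ext v
    by_cases hv : v = j
    · subst hv; simp [hj]
    · simp [hv]
  rw [this, Finset.card_insert_of_notMem (by simp [h])]

/-- An alternating tree rooted at the agent `i = p n`, with columns `used` and rows `rows`. -/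
structure Tree (n : ℕ) (w : ℕ → ℕ → ℝ) (M : ℕ → ℕ) (i : ℕ) (p : ℕ → ℕ) (u y : ℕ → ℝ)
    (used rows way : ℕ → ℕ) (minv : ℕ → ℝ) (ρ : ℕ → ℕ) : Prop where
  root : p n = i
  rows_iff : ∀ q < n, rows q = 1 ↔ q = i ∨ ∃ v < n, used v = 1 ∧ p v = q
  free : ∀ v < n, used v = 1 → M v = 0 ∧ p v < n
  -- For an unmarked column outside the tree, `minv` is its least slack over the rows of the tree,
  -- attained at the agent of its parent column `way v`. The value `n` of `way` stands for the root.
  minv_le : ∀ v < n, M v = 0 → used v ≠ 1 → ∀ q < n, rows q = 1 → minv v ≤ u q + y v - w q v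
  minv_eq : ∀ v < n, M v = 0 → used v ≠ 1 → (way v = n ∨ way v < n ∧ used (way v) = 1) ∧
    minv v = u (p (way v)) + y v - w (p (way v)) v
  -- The rank `ρ` is not stored by the machine. It decreases strictly from a column to its parent,
  -- which shows that the path of parents ends at the root.
  used_way : ∀ v < n, used v = 1 → (way v = n ∨ way v < n ∧ used (way v) = 1) ∧
    u (p (way v)) + y v = w (p (way v)) v ∧ ρ (way v) < ρ v
  rank_le : ∀ v, ρ v ≤ treeSize n used

/-- The row at which a column hangs. -/
theorem Tree.row_mem (h : Tree n w M i p u y used rows way minv ρ) (hi : i < n) {v : ℕ}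
    (hv : v = n ∨ v < n ∧ used v = 1) : p v < n ∧ rows (p v) = 1 := by
  rcases hv with rfl | ⟨hv, hu⟩
  · rw [h.root]
    exact ⟨hi, (h.rows_iff i hi).mpr (.inl rfl)⟩
  · have := (h.free v hv hu).2
    exact ⟨this, (h.rows_iff _ this).mpr (.inr ⟨v, hv, hu, rfl⟩)⟩

/-- The initial tree consists of the root row alone: the label of every column is its slack against
`i`, and every parent is the root. -/
theorem Tree.init (hi : i < n) (hroot : p n = i) (hused : ∀ v < n, used v = 0)
    (hrows : ∀ q < n, rows q = if q = i then 1 else 0)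
    (hway : ∀ v < n, way v = n) (hminv : ∀ v < n, minv v = u i + y v - w i v) :
    Tree n w M i p u y used rows way minv (fun _ => 0) where
  root := hroot
  rows_iff q hq := by
    rw [hrows q hq]
    constructor
    · intro h
      by_contra hne
      simp [not_or.mp hne |>.1] at h
    · rintro (rfl | ⟨v, hv, hu, -⟩)
      · simp
      · simp [hused v hv] at hu
  free v hv hu := by simp [hused v hv] at hu
  minv_le v hv _ _ q hq hr := by
    have : q = i := by
      by_contra hne
      simp [hrows q hq, hne] at hr
    rw [this, hminv v hv]
  minv_eq v hv _ _ := by rw [hway v hv, hroot]; exact ⟨.inl rfl, hminv v hv⟩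
  used_way v hv hu := by simp [hused v hv] at hu
  rank_le v := Nat.zero_le _

/-- As long as an unmarked agent is not seated, some unmarked seat is free. -/
theorem Tree.exists_unused (h : Tree n w M i p u y used rows way minv ρ)
    (hP : Partial n w A M p₀ i p u y) (hi : i < n) (hA : A i = 0) :
    ∃ v < n, M v = 0 ∧ used v ≠ 1 := by
  by_contra! hcon
  have hlt : ∀ v < n, p v < n := fun v hv => by
    by_cases hM : M v = 0
    · exact (h.free v hv (hcon v hv hM)).2
    · rw [(hP.fixed v hv hM).1]
      exact (hP.fixed v hv hM).2
  have hperm : Permutes n p := ⟨hlt, fun v hv v' hv' => hP.inj v hv v' hv' (hlt v hv)⟩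
  rcases (hP.range i hi).mp (hperm.surj hi) with h | h
  exacts [h hA, lt_irrefl _ h]

/-- The change of the potentials that makes a new column tight. -/
theorem Tree.update (h : Tree n w M i p u y used rows way minv ρ)
    (hP : Partial n w A M p₀ i p u y) (hi : i < n) (hA : A i = 0)
    {j : ℕ} (hj : j < n) (hMj : M j = 0) (huj : used j ≠ 1)
    (hmin : ∀ v < n, M v = 0 → used v ≠ 1 → minv j ≤ minv v) {u' y' minv' : ℕ → ℝ}
    (hu : ∀ q < n, u' q = if rows q = 1 then u q - minv j else u q)
    (hy : ∀ v < n, y' v = if used v = 1 then y v + minv j else y v)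
    (hm : ∀ v < n, minv' v = if used v = 1 then minv v else minv v - minv j) :
    Partial n w A M p₀ i p u' y' ∧ Tree n w M i p u' y' used rows way minv' ρ ∧ minv' j = 0 := by
  -- The label is an actual slack, hence nonnegative by feasibility.
  have hδ : 0 ≤ minv j := by
    obtain ⟨hw, he⟩ := h.minv_eq j hj hMj huj
    have := hP.feas _ (h.row_mem hi hw).1 j hj hMj
    linarith
  refine ⟨{ hP with feas := ?_, tight := ?_ },
    { h with minv_le := ?_, minv_eq := ?_, used_way := ?_ }, ?_⟩
  · intro q hq v hv hM
    have := hP.feas q hq v hv hM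
    rw [hu q hq, hy v hv]
    -- Only a tree row paired with a column outside the tree loses slack. It loses `minv j`, and its
    -- slack is at least `minv v`, which is at least `minv j` by the choice of `j`.
    split_ifs with h1 h2 h2
    · linarith
    · have := h.minv_le v hv hM h2 q hq h1
      have := hmin v hv hM h2
      linarith
    · linarith
    · linarith
  · intro v hv hM hpv
    have := hP.tight v hv hM hpv
    rw [hu _ hpv, hy v hv]
    by_cases h2 : used v = 1
    · have h1 : rows (p v) = 1 := (h.rows_iff _ hpv).mpr (.inr ⟨v, hv, h2, rfl⟩)
      rw [if_pos h1, if_pos h2]; linarith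
    -- The agent of a column outside the tree is no row of the tree: it is not the root, which is
    -- still unseated, and by injectivity it sits at no column of the tree. So neither potential of
    -- this tight pair changes.
    · have h1 : rows (p v) ≠ 1 := by
        intro h1
        rcases (h.rows_iff _ hpv).mp h1 with h1 | ⟨v', hv', hu', he⟩
        · rcases (hP.range i hi).mp ⟨v, hv, h1⟩ with hr | hr
          exacts [hr hA, lt_irrefl _ hr]
        · exact h2 (hP.inj v hv v' hv' hpv he.symm ▸ hu')
      rw [if_neg h1, if_neg h2]; linarith
  · intro v hv hM h2 q hq h1
    rw [hm v hv, hu q hq, hy v hv, if_neg h2, if_neg h2, if_pos h1]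
    have := h.minv_le v hv hM h2 q hq h1
    linarith
  · intro v hv hM h2
    obtain ⟨hw, he⟩ := h.minv_eq v hv hM h2
    obtain ⟨hlt, h1⟩ := h.row_mem hi hw
    refine ⟨hw, ?_⟩
    rw [hm v hv, hu _ hlt, hy v hv, if_neg h2, if_neg h2, if_pos h1]
    linarith
  · intro v hv h2
    obtain ⟨hw, he, hr⟩ := h.used_way v hv h2
    obtain ⟨hlt, h1⟩ := h.row_mem hi hw
    refine ⟨hw, ?_, hr⟩
    rw [hu _ hlt, hy v hv, if_pos h2, if_pos h1]
    linarith
  · rw [hm j hj, if_neg huj, sub_self]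

/-- A tight column that is not free is added to the tree, together with its row. -/
theorem Tree.grow (h : Tree n w M i p u y used rows way minv ρ)
    (hP : Partial n w A M p₀ i p u y) {j : ℕ} (hj : j < n) (hMj : M j = 0) (huj : used j ≠ 1)
    (hpj : p j < n) (hmj : minv j = 0) {way' : ℕ → ℕ} {minv' : ℕ → ℝ}
    (hout : ∀ v < n, M v ≠ 0 ∨ used v = 1 ∨ v = j → way' v = way v)
    (hlt : ∀ v < n, M v = 0 → used v ≠ 1 → v ≠ j → u (p j) + y v - w (p j) v ≤ minv v →
      way' v = j ∧ minv' v = u (p j) + y v - w (p j) v)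
    (hge : ∀ v < n, M v = 0 → used v ≠ 1 → v ≠ j → ¬ u (p j) + y v - w (p j) v ≤ minv v →
      way' v = way v ∧ minv' v = minv v) :
    Tree n w M i p u y (Function.update used j 1) (Function.update rows (p j) 1) way' minv'
      (Function.update ρ j (treeSize n used + 1)) := by
  have hnj : n ≠ j := by omega
  have hw' : ∀ v, (v = n ∨ v < n ∧ used v = 1) →
      v ≠ j ∧ (v = n ∨ v < n ∧ Function.update used j 1 v = 1) := by
    rintro v (rfl | ⟨hv, hu⟩)
    · exact ⟨hnj, .inl rfl⟩
    · have : v ≠ j := by rintro rfl; exact huj hu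
      exact ⟨this, .inr ⟨hv, by simpa [this] using hu⟩⟩
  refine ⟨h.root, ?_, ?_, ?_, ?_, ?_, ?_⟩
  · intro q hq
    by_cases hqj : q = p j
    · subst hqj
      simp only [Function.update_self, true_iff]
      exact .inr ⟨j, hj, by simp, rfl⟩
    · rw [Function.update_of_ne hqj, h.rows_iff q hq]
      refine or_congr Iff.rfl (exists_congr fun v => and_congr_right fun hv => ?_)
      by_cases hvj : v = j
      · subst hvj
        simp [huj, Ne.symm hqj]
      · simp [hvj]
  · intro v hv hu
    by_cases hvj : v = j
    · subst hvj; exact ⟨hMj, hpj⟩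
    · exact h.free v hv (by simpa [hvj] using hu)
  · intro v hv hM hu q hq hr
    have hvj : v ≠ j := by rintro rfl; simp at hu
    rw [Function.update_of_ne hvj] at hu
    by_cases hle : u (p j) + y v - w (p j) v ≤ minv v
    · rw [(hlt v hv hM hu hvj hle).2]
      by_cases hqj : q = p j
      · rw [hqj]
      · rw [Function.update_of_ne hqj] at hr
        exact hle.trans (h.minv_le v hv hM hu q hq hr)
    · rw [(hge v hv hM hu hvj hle).2]
      by_cases hqj : q = p j
      · rw [hqj]; exact (not_le.mp hle).le
      · rw [Function.update_of_ne hqj] at hr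
        exact h.minv_le v hv hM hu q hq hr
  · intro v hv hM hu
    have hvj : v ≠ j := by rintro rfl; simp at hu
    rw [Function.update_of_ne hvj] at hu
    by_cases hle : u (p j) + y v - w (p j) v ≤ minv v
    · rw [(hlt v hv hM hu hvj hle).1, (hlt v hv hM hu hvj hle).2]
      exact ⟨.inr ⟨hj, by simp⟩, rfl⟩
    · rw [(hge v hv hM hu hvj hle).1, (hge v hv hM hu hvj hle).2]
      obtain ⟨h1, h2⟩ := h.minv_eq v hv hM hu
      exact ⟨(hw' _ h1).2, h2⟩
  · intro v hv hu
    by_cases hvj : v = j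
    · subst hvj
      obtain ⟨h1, h2⟩ := h.minv_eq v hv hMj huj
      rw [hout v hv (.inr (.inr rfl))]
      refine ⟨(hw' _ h1).2, by linarith, ?_⟩
      rw [Function.update_of_ne (hw' _ h1).1, Function.update_self]
      -- The new column gets rank `treeSize + 1`, which exceeds all ranks given so far, in
      -- particular that of its parent.
      have := h.rank_le (way v)
      omega
    · rw [Function.update_of_ne hvj] at hu
      obtain ⟨h1, h2, h3⟩ := h.used_way v hv hu
      rw [hout v hv (.inr (.inl hu))]
      refine ⟨(hw' _ h1).2, h2, ?_⟩
      rwa [Function.update_of_ne (hw' _ h1).1, Function.update_of_ne hvj]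
  · intro v
    rw [treeSize_update hj huj]
    by_cases hvj : v = j
    · simp [hvj]
    · rw [Function.update_of_ne hvj]
      exact (h.rank_le v).trans (Nat.le_succ _)

/-! ### Augmentation along a path of the tree -/

/-- The invariant of the augmentation: the column `j` is the one whose agent has moved on; `p₁` is
the seating before the augmentation, and `S` contains the columns of the tree. -/
structure Augment (n : ℕ) (w : ℕ → ℕ → ℝ) (A M p₀ : ℕ → ℕ) (i : ℕ) (u y : ℕ → ℝ) (way ρ : ℕ → ℕ)
    (S : ℕ → Prop) (p₁ p : ℕ → ℕ) (j : ℕ) : Prop where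
  hole : j = n ∨ j < n ∧ S j
  chain : ∀ v < n, S v → M v = 0 ∧ (way v = n ∨ way v < n ∧ S (way v)) ∧
    u (p₁ (way v)) + y v = w (p₁ (way v)) v ∧ ρ (way v) < ρ v
  -- Seats of rank at most that of the hole are still untouched, so the next agent to move is the
  -- one that the tight tree edge refers to.
  old : ∀ v, ρ v ≤ ρ j → p v = p₁ v
  tight : ∀ v < n, v ≠ j → M v = 0 → p v < n → u (p v) + y v = w (p v) v
  le : ∀ v ≤ n, p v ≤ n
  inj : ∀ v ≤ n, v ≠ j → ∀ v' ≤ n, v' ≠ j → p v < n → p v = p v' → v = v'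
  range : ∀ q < n, (∃ v ≤ n, v ≠ j ∧ p v = q) ↔ (A q ≠ 0 ∨ q < i + 1)
  fixed : ∀ v < n, M v ≠ 0 → p v = p₀ v ∧ p₀ v < n

/-- The new agent `i` is regarded as sitting on a virtual seat `n`, and the free column `j` as a
hole. The agents seated away from the hole are then already those required after the round, and the
path of parents from `j` leads to the virtual seat through tight pairs. -/
theorem Tree.augment (h : Tree n w M i p u y used rows way minv ρ)
    (hP : Partial n w A M p₀ i p u y) (hi : i < n) (hA : A i = 0) {j : ℕ} (hj : j < n)
    (hMj : M j = 0) (huj : used j ≠ 1) (hpj : p j = n) (hmj : minv j = 0) :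
    Augment n w A M p₀ i u y way (Function.update ρ j (treeSize n used + 1))
      (fun v => used v = 1 ∨ v = j) p p j := by
  have hnew : ∀ v < n, p v ≠ i := fun v hv he => by
    rcases (hP.range i hi).mp ⟨v, hv, he⟩ with hr | hr
    exacts [hr hA, lt_irrefl _ hr]
  have hw : ∀ v, (v = n ∨ v < n ∧ used v = 1) →
      v ≠ j ∧ (v = n ∨ v < n ∧ (used v = 1 ∨ v = j)) := by
    rintro v (rfl | ⟨hv, hu⟩)
    · exact ⟨by omega, .inl rfl⟩
    · have : v ≠ j := by rintro rfl; exact huj hu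
      exact ⟨this, .inr ⟨hv, .inl hu⟩⟩
  refine ⟨.inr ⟨hj, .inr rfl⟩, ?_, fun _ _ => rfl, fun v hv _ => hP.tight v hv, ?_, ?_, ?_,
    hP.fixed⟩
  · intro v hv hS
    by_cases hvj : v = j
    · subst hvj
      obtain ⟨h1, h2⟩ := h.minv_eq v hv hMj huj
      refine ⟨hMj, (hw _ h1).2, by linarith, ?_⟩
      rw [Function.update_of_ne (hw _ h1).1, Function.update_self]
      have := h.rank_le (way v)
      omega
    · have hu := hS.resolve_right hvj
      obtain ⟨h1, h2, h3⟩ := h.used_way v hv hu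
      refine ⟨(h.free v hv hu).1, (hw _ h1).2, h2, ?_⟩
      rwa [Function.update_of_ne (hw _ h1).1, Function.update_of_ne hvj]
  · intro v hv
    rcases hv.lt_or_eq with hv | rfl
    · exact hP.le v hv
    · rw [h.root]; exact hi.le
  · intro v hv hvj v' hv' hvj' hpv he
    rcases hv.lt_or_eq with hv | rfl <;> rcases hv'.lt_or_eq with hv' | rfl
    · exact hP.inj v hv v' hv' hpv he
    · exact absurd (he.trans h.root) (hnew v hv)
    · exact absurd (he.symm.trans h.root) (hnew v' hv')
    · rfl
  · intro q hq
    constructor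
    · rintro ⟨v, hv, hvj, he⟩
      rcases hv.lt_or_eq with hv | rfl
      · rcases (hP.range q hq).mp ⟨v, hv, he⟩ with h | h
        exacts [.inl h, .inr (by omega)]
      · exact .inr (by rw [← he, h.root]; omega)
    · intro hq'
      by_cases hqi : q = i
      · exact ⟨n, le_rfl, by omega, by rw [h.root, hqi]⟩
      · obtain ⟨v, hv, he⟩ := (hP.range q hq).mpr (hq'.imp_right (by omega))
        refine ⟨v, hv.le, ?_, he⟩
        rintro rfl
        omega

/-- The agent of the parent column moves into the hole, and the hole moves to the parent. The stale
entry left there is disregarded, so injectivity and the set of seated agents survive. The new pair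
is tight because it is a tree edge, and the rank of the hole falls. -/
theorem Augment.step {S : ℕ → Prop} {p₁ : ℕ → ℕ} {j : ℕ}
    (h : Augment n w A M p₀ i u y way ρ S p₁ p j) (hj : j < n) :
    Augment n w A M p₀ i u y way ρ S p₁ (Function.update p j (p (way j))) (way j) ∧
      ρ (way j) < ρ j := by
  have hS : S j := h.hole.resolve_left (by omega) |>.2
  obtain ⟨hM, hw, ht, hr⟩ := h.chain j hj hS
  have hwj : way j ≠ j := fun he => by rw [he] at hr; exact lt_irrefl _ hr
  have hwn : way j ≤ n := by omega
  refine ⟨⟨hw, h.chain, ?_, ?_, ?_, ?_, ?_, ?_⟩, hr⟩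
  · intro v hv
    have hvj : v ≠ j := by rintro rfl; omega
    rw [Function.update_of_ne hvj]
    exact h.old v (by omega)
  · intro v hv hvw hMv hpv
    by_cases hvj : v = j
    · subst hvj
      rw [Function.update_self, h.old _ hr.le]
      exact ht
    · rw [Function.update_of_ne hvj] at hpv ⊢
      exact h.tight v hv hvj hMv hpv
  · intro v hv
    by_cases hvj : v = j
    · rw [hvj, Function.update_self]; exact h.le _ hwn
    · rw [Function.update_of_ne hvj]; exact h.le _ hv
  · intro v hv hvw v' hv' hvw' hpv he
    by_cases hvj : v = j <;> by_cases hvj' : v' = j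
    · rw [hvj, hvj']
    · subst hvj
      rw [Function.update_self] at hpv
      rw [Function.update_self, Function.update_of_ne hvj'] at he
      exact absurd (h.inj _ hwn hwj _ hv' hvj' hpv he) hvw'.symm
    · subst hvj'
      rw [Function.update_of_ne hvj] at hpv
      rw [Function.update_self, Function.update_of_ne hvj] at he
      exact absurd (h.inj _ hv hvj _ hwn hwj hpv he) hvw
    · rw [Function.update_of_ne hvj] at hpv
      rw [Function.update_of_ne hvj, Function.update_of_ne hvj'] at he
      exact h.inj _ hv hvj _ hv' hvj' hpv he
  · intro q hq
    rw [← h.range q hq]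
    constructor
    · rintro ⟨v, hv, hvw, he⟩
      by_cases hvj : v = j
      · subst hvj
        rw [Function.update_self] at he
        exact ⟨way v, hwn, hwj, he⟩
      · rw [Function.update_of_ne hvj] at he
        exact ⟨v, hv, hvj, he⟩
    · rintro ⟨v, hv, hvj, he⟩
      by_cases hvw : v = way j
      · exact ⟨j, hj.le, hwj.symm, by rw [Function.update_self, ← hvw, he]⟩
      · exact ⟨v, hv, hvw, by rw [Function.update_of_ne hvj, he]⟩
  · intro v hv hMv
    have hvj : v ≠ j := by rintro rfl; exact hMv hM
    rw [Function.update_of_ne hvj]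
    exact h.fixed v hv hMv

/-- Once the hole is the virtual seat, all agents counted sit on real seats. -/
theorem Augment.done {S : ℕ → Prop} {p₁ : ℕ → ℕ}
    (h : Augment n w A M p₀ i u y way ρ S p₁ p n)
    (hfeas : ∀ q < n, ∀ v < n, M v = 0 → w q v ≤ u q + y v) :
    Partial n w A M p₀ (i + 1) p u y where
  feas := hfeas
  tight v hv := h.tight v hv hv.ne
  le v hv := h.le v hv.le
  inj v hv v' hv' := h.inj v hv.le hv.ne v' hv'.le hv'.ne
  range q hq := by
    rw [← h.range q hq]
    constructor
    · rintro ⟨v, hv, he⟩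
      exact ⟨v, hv.le, hv.ne, he⟩
    · rintro ⟨v, hv, hne, he⟩
      exact ⟨v, by omega, he⟩
  fixed := h.fixed

/-! ### Optimality by duality -/

/-- When all agents are seated, the seating is of maximum weight among those that agree with it on
the marked seats. -/
theorem Partial.permutes (h : Partial n w A M p₀ n p u y) : Permutes n p :=
  permutes_of_surj fun q hq => (h.range q hq).mpr (.inr hq)

/-- Weak duality bounds the weight of `σ` on the unmarked seats by the sum of the potentials, and
tightness makes this an equality for `p`. Both potential sums agree: `σ` and `p` coincide on the
marked seats, and the sum of `u` over all agents does not depend on the seating. -/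
theorem Partial.optimal (h : Partial n w A M p₀ n p u y) {σ : ℕ → ℕ} (hσ : Permutes n σ)
    (hfix : ∀ v < n, M v ≠ 0 → σ v = p v) :
    ∑ v ∈ (Finset.range n).filter (fun v => M v = 0), w (σ v) v ≤
      ∑ v ∈ (Finset.range n).filter (fun v => M v = 0), w (p v) v := by
  have hp := h.permutes
  have h1 : ∑ v ∈ (Finset.range n).filter (fun v => M v = 0), w (σ v) v ≤
      ∑ v ∈ (Finset.range n).filter (fun v => M v = 0), (u (σ v) + y v) := by
    refine Finset.sum_le_sum fun v hv => ?_
    rw [Finset.mem_filter, Finset.mem_range] at hv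
    exact h.feas _ (hσ.1 v hv.1) v hv.1 hv.2
  have h2 : ∑ v ∈ (Finset.range n).filter (fun v => M v = 0), w (p v) v =
      ∑ v ∈ (Finset.range n).filter (fun v => M v = 0), (u (p v) + y v) := by
    refine Finset.sum_congr rfl fun v hv => ?_
    rw [Finset.mem_filter, Finset.mem_range] at hv
    exact (h.tight v hv.1 hv.2 (hp.1 v hv.1)).symm
  have h3 : ∑ v ∈ (Finset.range n).filter (fun v => ¬ M v = 0), u (σ v) =
      ∑ v ∈ (Finset.range n).filter (fun v => ¬ M v = 0), u (p v) := by
    refine Finset.sum_congr rfl fun v hv => ?_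
    rw [Finset.mem_filter, Finset.mem_range] at hv
    rw [hfix v hv.1 hv.2]
  have h4 := hσ.sum_comp u
  have h5 := hp.sum_comp u
  rw [← Finset.sum_filter_add_sum_filter_not _ (fun v => M v = 0)] at h4 h5
  rw [Finset.sum_add_distrib] at h1 h2
  linarith

end Assignment

/-! ### Welfare as a function of the seating -/

/-- The welfare of the seating `σ` of the agents below `n`. -/
noncomputable def welfare (n : ℕ) (adj : ℕ → ℕ → Prop) (g : ℕ → ℕ → ℝ) (σ : ℕ → ℕ) : ℝ :=
  open Classical in
  ∑ v ∈ Finset.range n, ∑ x ∈ Finset.range n, if adj v x then g (σ v) (σ x) else 0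

/-- What it is worth to have agent `q` at `v`, when `p` seats agents on the marked seats. -/
noncomputable def seatWeight (n : ℕ) (adj : ℕ → ℕ → Prop) (g : ℕ → ℕ → ℝ) (M p : ℕ → ℕ)
    (q v : ℕ) : ℝ :=
  open Classical in
  ∑ x ∈ Finset.range n, if adj v x ∧ M x ≠ 0 then g q (p x) + g (p x) q else 0

-- Sort the ordered adjacent pairs by which ends are marked. Pairs with two marked ends give a
-- constant, pairs with none do not exist because the marks form a cover, and the two orders of a
-- pair with one marked end both belong to the weight of its unmarked seat.
open Classical in
theorem welfare_eq {n : ℕ} {adj : ℕ → ℕ → Prop} {g : ℕ → ℕ → ℝ} {M p σ : ℕ → ℕ}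
    (hsymm : ∀ v x, adj v x → adj x v)
    (hcover : ∀ v < n, ∀ x < n, adj v x → M v ≠ 0 ∨ M x ≠ 0)
    (hfix : ∀ v < n, M v ≠ 0 → σ v = p v) :
    welfare n adj g σ =
      (∑ v ∈ Finset.range n, ∑ x ∈ Finset.range n,
        if adj v x ∧ M v ≠ 0 ∧ M x ≠ 0 then g (p v) (p x) else 0) +
      ∑ v ∈ (Finset.range n).filter (fun v => M v = 0), seatWeight n adj g M p (σ v) v := by
  have h1 : ∑ v ∈ (Finset.range n).filter (fun v => M v = 0), seatWeight n adj g M p (σ v) v =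
      (∑ v ∈ Finset.range n, ∑ x ∈ Finset.range n,
        if adj v x ∧ M v = 0 ∧ M x ≠ 0 then g (σ v) (σ x) else 0) +
      ∑ v ∈ Finset.range n, ∑ x ∈ Finset.range n,
        if adj v x ∧ M v ≠ 0 ∧ M x = 0 then g (σ v) (σ x) else 0 := by
    -- The pairs whose first end is the marked one are reindexed by their second end, so that both
    -- families are sums over the unmarked seat.
    rw [Finset.sum_comm (f := fun v x => if adj v x ∧ M v ≠ 0 ∧ M x = 0 then g (σ v) (σ x) else 0),
      ← Finset.sum_add_distrib, Finset.sum_filter]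
    refine Finset.sum_congr rfl fun v hv => ?_
    rw [← Finset.sum_add_distrib]
    by_cases hM : M v = 0
    · simp only [seatWeight, hM, if_true, and_true, true_and]
      refine Finset.sum_congr rfl fun x hx => ?_
      have hadj : adj x v ↔ adj v x := ⟨hsymm _ _, hsymm _ _⟩
      by_cases ha : adj v x ∧ M x ≠ 0
      · rw [hfix x (Finset.mem_range.mp hx) ha.2]
        simp [hadj, ha]
      · simp [hadj, ha]
    · simp [hM]
  rw [h1, welfare, ← Finset.sum_add_distrib, ← Finset.sum_add_distrib]
  refine Finset.sum_congr rfl fun v hv => ?_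
  rw [← Finset.sum_add_distrib, ← Finset.sum_add_distrib]
  refine Finset.sum_congr rfl fun x hx => ?_
  rw [Finset.mem_range] at hv hx
  by_cases ha : adj v x
  · rcases hcover v hv x hx ha with h | h
    · by_cases h' : M x = 0
      · simp [ha, h, h']
      · simp [ha, h, h', hfix v hv h, hfix x hx h']
    · by_cases h' : M v = 0
      · simp [ha, h, h']
      · simp [ha, h, h', hfix v hv h', hfix x hx h]
  · simp [ha]

/-- The constant in `welfare_eq` is the same for all seatings that agree on the cover, so maximising
the assignment weight maximises the welfare among them. -/
theorem Partial.welfare_le {n : ℕ} {adj : ℕ → ℕ → Prop} {g : ℕ → ℕ → ℝ} {A M p₀ p : ℕ → ℕ}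
    {u y : ℕ → ℝ} (h : Partial n (seatWeight n adj g M p₀) A M p₀ n p u y)
    (hsymm : ∀ v x, adj v x → adj x v)
    (hcover : ∀ v < n, ∀ x < n, adj v x → M v ≠ 0 ∨ M x ≠ 0)
    {σ : ℕ → ℕ} (hσ : Permutes n σ) (hfix : ∀ v < n, M v ≠ 0 → σ v = p₀ v) :
    welfare n adj g σ ≤ welfare n adj g p := by
  rw [welfare_eq hsymm hcover hfix, welfare_eq hsymm hcover fun v hv hM => (h.fixed v hv hM).1]
  have := h.optimal hσ fun v hv hM => (hfix v hv hM).trans (h.fixed v hv hM).1.symm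
  linarith

/-! ### The input -/

/-- The state holds `n`, the adjacency relation `adj`, the preferences `g`, and the offsets of the
rows of `n × n` matrices. -/
structure Input (n : ℕ) (adj : ℕ → ℕ → Prop) (g : ℕ → ℕ → ℝ) (s : State) : Prop where
  size : s.nReg 0 = n
  adj_iff : ∀ v < n, ∀ x < n, 1 ≤ s.nArr 0 (v * n + x) ↔ adj v x
  pref : ∀ q < n, ∀ r < n, s.rArr 0 (q * n + r) = g q r
  off : ∀ v < n, s.nArr 5 v = v * n

theorem Input.of_frame {n : ℕ} {adj : ℕ → ℕ → Prop} {g : ℕ → ℕ → ℝ} {s s' : State} {c : Prog}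
    (h : Input n adj g s) (hF : Frame c s s') (h₀ : c.setsN 0 = false := by rfl)
    (h₁ : c.putsN 0 = false := by rfl) (h₂ : c.putsN 5 = false := by rfl)
    (h₃ : c.putsR 0 = false := by rfl) : Input n adj g s' where
  size := by rw [hF.nReg 0 h₀, h.size]
  adj_iff := by rw [hF.nArr 0 h₁]; exact h.adj_iff
  pref := by rw [hF.rArr 0 h₃]; exact h.pref
  off := by rw [hF.nArr 5 h₂]; exact h.off

/-! ### Counting through tuples -/

infixr:60 " ⨟ " => Prog.seq

/-- The number whose base `n` digits are the first `k` entries of `D`. -/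
def digitsValue (n k : ℕ) (D : ℕ → ℕ) : ℕ := ∑ t ∈ Finset.range k, D t * n ^ t

theorem digitsValue_zero {n k : ℕ} {D : ℕ → ℕ} (h : ∀ t < k, D t = 0) :
    digitsValue n k D = 0 :=
  Finset.sum_eq_zero fun t ht => by rw [h t (Finset.mem_range.mp ht), zero_mul]

theorem digitsValue_lt {n k : ℕ} {D : ℕ → ℕ} (h : ∀ t < k, D t < n) :
    digitsValue n k D < n ^ k := by
  induction k with
  | zero => simp [digitsValue]
  | succ k ih =>
    have h1 := ih fun t ht => h t (by omega)
    have h2 : (D k + 1) * n ^ k ≤ n * n ^ k := Nat.mul_le_mul_right _ (h k (by omega))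
    rw [digitsValue, Finset.sum_range_succ, ← digitsValue, pow_succ']
    rw [Nat.succ_mul] at h2
    omega

theorem digitsValue_inj {n k : ℕ} {D D' : ℕ → ℕ} (h : ∀ t < k, D t < n) (h' : ∀ t < k, D' t < n)
    (he : digitsValue n k D = digitsValue n k D') : ∀ t < k, D t = D' t := by
  induction k with
  | zero => simp
  | succ k ih =>
    have h1 := digitsValue_lt fun t (ht : t < k) => h t (by omega)
    have h1' := digitsValue_lt fun t (ht : t < k) => h' t (by omega)
    rw [digitsValue, digitsValue, Finset.sum_range_succ, Finset.sum_range_succ, ← digitsValue,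
      ← digitsValue] at he
    have hk : D k = D' k := by
      rcases lt_trichotomy (D k) (D' k) with hlt | heq | hlt
      · have := Nat.mul_le_mul_right (n ^ k) hlt
        rw [Nat.succ_mul] at this
        omega
      · exact heq
      · have := Nat.mul_le_mul_right (n ^ k) hlt
        rw [Nat.succ_mul] at this
        omega
    rw [hk] at he
    intro t ht
    rcases Nat.lt_succ_iff_lt_or_eq.mp ht with ht | rfl
    · exact ih (fun t ht => h t (by omega)) (fun t ht => h' t (by omega)) (by omega) t ht
    · exact hk

/-- The effect of changing one digit, written additively to avoid truncated subtraction. -/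
theorem digitsValue_update {n k j x : ℕ} (D : ℕ → ℕ) (hj : j < k) :
    digitsValue n k (Function.update D j x) + D j * n ^ j = digitsValue n k D + x * n ^ j := by
  have hj' : j ∈ Finset.range k := Finset.mem_range.mpr hj
  rw [digitsValue, digitsValue, ← Finset.add_sum_erase _ _ hj',
    ← Finset.add_sum_erase _ (fun t => D t * n ^ t) hj', Function.update_self,
    Finset.sum_congr rfl (g := fun t => D t * n ^ t) fun t ht => by
      rw [Function.update_of_ne (Finset.ne_of_mem_erase ht)]]
  ring

/-- Pass to the next tuple: tuples of length `k` (register 1), with entries below `n`, stand in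
array 2. After the last tuple of length `k` comes the first one of length `k + 1`. -/
def nextTuple : Prog :=
  .nSet 2 (.const 0) ⨟
  .while (.and (.nle (.add (.reg 2) (.const 1)) (.reg 1))
      (.nle (.reg 0) (.add (.get 2 (.reg 2)) (.const 1))))
    (.nPut 2 (.reg 2) (.const 0) ⨟ .nSet 2 (.add (.reg 2) (.const 1))) ⨟
  .ite (.nle (.add (.reg 2) (.const 1)) (.reg 1))
    (.nPut 2 (.reg 2) (.add (.get 2 (.reg 2)) (.const 1)))
    (.nSet 1 (.add (.reg 1) (.const 1)) ⨟ .nPut 2 (.reg 2) (.const 0))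

/-- This is addition of 1 with carry. After the first `j` digits have been reset, the value plus the
pending carry `n ^ j` equals the old value plus 1. The carry goes into the first digit that is not
maximal; if there is none, all digits are zero and the old value was `n ^ k - 1`. -/
theorem run_nextTuple {n k : ℕ} {s : State} (hn : s.nReg 0 = n) (hk : s.nReg 1 = k)
    (hD : ∀ t < k, s.nArr 2 t < n) :
    Run nextTuple s (40 * (k + 1)) (fun s' =>
      (s'.nReg 1 = k ∧ (∀ t < k, s'.nArr 2 t < n) ∧
        digitsValue n k (s'.nArr 2) = digitsValue n k (s.nArr 2) + 1) ∨
      (s'.nReg 1 = k + 1 ∧ (∀ t < k + 1, s'.nArr 2 t = 0) ∧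
        digitsValue n k (s.nArr 2) + 1 = n ^ k)) := by
  refine Run.seq (T₁ := 2) (T₂ := 30 * k + 37) (R := fun s' => s' = s.setN 2 0)
    (.straight rfl (by decide) rfl) ?_ (by omega)
  rintro _ rfl
  refine Run.seq (T₁ := 30 * k + 15) (T₂ := 20) (Run.while (K := k) (T := 8)
    (fun m s' => ∃ j, s'.nReg 2 = j ∧ j + m = k ∧ (∀ t < j, s'.nArr 2 t = 0) ∧
      (∀ t ≥ j, s'.nArr 2 t = s.nArr 2 t) ∧
      digitsValue n k (s'.nArr 2) + n ^ j = digitsValue n k (s.nArr 2) + 1)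
    ⟨0, by simp, by omega, by simp, by simp, by simp⟩ ?_ ?_) ?_ (by omega)
  · rintro m s' hF ⟨j, hj, hjm, hz, hold, hval⟩ hb
    have hn' : s'.nReg 0 = n := by rw [hF.nReg 0 rfl]; simpa using hn
    have hk' : s'.nReg 1 = k := by rw [hF.nReg 1 rfl]; simpa using hk
    simp only [BExp.Holds, NExp.eval, hn', hk', hj] at hb
    have hjn := hD j (by omega)
    have hup := digitsValue_update (n := n) (k := k) (x := 0) (s'.nArr 2) (j := j) (by omega)
    refine .straight rfl (by decide) ⟨m - 1, by omega, j + 1, by simp [hj], by omega, ?_, ?_, ?_⟩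
    · intro t ht
      by_cases htj : t = j
      · simp [hj, htj]
      · simpa [hj, htj] using hz t (by omega)
    · intro t ht
      have htj : t ≠ j := by omega
      simpa [hj, htj] using hold t (by omega)
    -- The loop test found the digit maximal, so resetting it turns the carry `n ^ j` into `n ^ (j +
    -- 1)`.
    · have hDj : s'.nArr 2 j + 1 = n := by rw [hold j le_rfl]; rw [hold j le_rfl] at hb; omega
      have hpow : n ^ (j + 1) = s'.nArr 2 j * n ^ j + n ^ j := by
        rw [pow_succ', ← Nat.succ_mul, ← hDj]
      simp only [Prog.run, NExp.eval, State.setN_nArr, State.putN_nArr, if_pos, hj]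
      rw [hpow]
      omega
  · simp only [BExp.cost, NExp.cost]
    omega
  · rintro s' ⟨⟨m, j, hj, hjm, hz, hold, hval⟩, hb, hF⟩
    have hn' : s'.nReg 0 = n := by rw [hF.nReg 0 rfl]; simpa using hn
    have hk' : s'.nReg 1 = k := by rw [hF.nReg 1 rfl]; simpa using hk
    simp only [BExp.Holds, NExp.eval, hn', hk', hj, not_and] at hb
    refine Run.ite (T := 8) ?_ ?_ (by simp only [BExp.cost, NExp.cost]; omega)
    · intro hlt
      simp only [BExp.Holds, NExp.eval, hj, hk'] at hlt
      have hup := digitsValue_update (n := n) (k := k) (x := s'.nArr 2 j + 1) (s'.nArr 2) (j := j)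
        (by omega)
      refine .straight rfl (by decide) (.inl ⟨by simpa using hk', ?_, ?_⟩)
      · intro t ht
        by_cases htj : t = j
        · simp only [Prog.run, NExp.eval, State.putN_nArr, if_pos, hj, htj, Function.update_self]
          have := hb hlt
          omega
        · simp only [Prog.run, NExp.eval, State.putN_nArr, if_pos, hj, Function.update_of_ne htj]
          by_cases htj' : t < j
          · rw [hz t htj']; exact (Nat.zero_le _).trans_lt (hD t ht)
          · rw [hold t (by omega)]; exact hD t ht
      · simp only [Prog.run, NExp.eval, State.putN_nArr, if_pos, hj]
        rw [Nat.succ_mul] at hup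
        omega
    · intro hlt
      simp only [BExp.Holds, NExp.eval, hj, hk'] at hlt
      have hjk : j = k := by omega
      subst hjk
      refine .straight rfl (by decide) (.inr ⟨by simp [hk'], ?_, ?_⟩)
      · intro t ht
        by_cases htj : t = j
        · simp [hj, htj]
        · simpa [hj, htj] using hz t (by omega)
      · rw [digitsValue_zero hz] at hval
        omega

/-! ### Testing for a vertex cover -/

/-- Mark the entries of the current tuple in array 4, and let register 4 tell whether every edge
has a marked end. -/
def checkCover : Prog :=
  .forTo 5 0 (.nPut 4 (.reg 5) (.const 0)) ⨟
  .forTo 5 1 (.nPut 4 (.get 2 (.reg 5)) (.const 1)) ⨟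
  .nSet 4 (.const 1) ⨟
  .forTo 5 0 (.forTo 6 0
    (.ite (.and (.nle (.const 1) (.get 0 (.add (.get 5 (.reg 5)) (.reg 6))))
        (.and (.nle (.get 4 (.reg 5)) (.const 0)) (.nle (.get 4 (.reg 6)) (.const 0))))
      (.nSet 4 (.const 0)) .skip))

/-- Every edge has an end that is marked. -/
def Covers (n : ℕ) (adj : ℕ → ℕ → Prop) (M : ℕ → ℕ) : Prop :=
  ∀ v < n, ∀ x < n, adj v x → M v ≠ 0 ∨ M x ≠ 0

theorem run_checkCover {n k : ℕ} {adj : ℕ → ℕ → Prop} {g : ℕ → ℕ → ℝ} {s : State}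
    (hin : Input n adj g s) (hk : s.nReg 1 = k) (hkn : k ≤ n) (hn : 1 ≤ n) :
    Run checkCover s (200 * n ^ 2) (fun s' =>
      (∀ v < n, s'.nArr 4 v ≠ 0 ↔ ∃ t < k, s.nArr 2 t = v) ∧
      (s'.nReg 4 ≠ 0 ↔ Covers n adj (s'.nArr 4))) := by
  have hnn : n ≤ n ^ 2 := Nat.le_self_pow (by norm_num) n
  refine Run.seq (T₂ := 150 * n ^ 2) (Run.forTo (T := 4) (N := n)
    (fun j s' => ∀ v < j, s'.nArr 4 v = 0) hin.size (by decide) rfl rfl (by simp) ?_ le_rfl) ?_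
    (by omega)
  · intro j hj s' hF hx hI
    refine .straight rfl (by decide) ?_
    intro v hv
    by_cases hvj : v = j
    · simp [hx, hvj]
    · simpa [hx, hvj] using hI v (by omega)
  rintro s₁ ⟨h₁, F₁⟩
  refine Run.seq (T₂ := 120 * n ^ 2) (Run.forTo (T := 8) (N := k)
    (fun j s' => ∀ v < n, s'.nArr 4 v ≠ 0 ↔ ∃ t < j, s.nArr 2 t = v)
    ((F₁.nReg 1 rfl).trans hk) (by decide) rfl rfl (by simpa using h₁) ?_ le_rfl) ?_
    (by omega)
  · intro j hj s' hF hx hI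
    have hD : s'.nArr 2 = s.nArr 2 := by rw [hF.nArr 2 rfl, F₁.nArr 2 rfl]
    refine .straight rfl (by decide) ?_
    intro v hv
    by_cases hvj : v = s.nArr 2 j
    · simp only [Prog.run, NExp.eval, hx, hD, State.setN_nArr, State.putN_nArr, if_pos, hvj,
        Function.update_self]
      exact ⟨fun _ => ⟨j, by omega, rfl⟩, fun _ => one_ne_zero⟩
    · simp only [Prog.run, NExp.eval, hx, hD, State.setN_nArr, State.putN_nArr, if_pos,
        Function.update_of_ne hvj, hI v hv]
      constructor
      · rintro ⟨t, ht, he⟩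
        exact ⟨t, by omega, he⟩
      · rintro ⟨t, ht, he⟩
        refine ⟨t, ?_, he⟩
        have : t ≠ j := by rintro rfl; exact hvj he.symm
        omega
  rintro s₂ ⟨h₂, F₂⟩
  refine Run.seq (T₁ := 2) (T₂ := 110 * n ^ 2) (R := fun s' => s' = s₂.setN 4 1)
    (.straight rfl (by decide) rfl) ?_ (by omega)
  rintro _ rfl
  have hin₂ : Input n adj g s₂ := (hin.of_frame F₁).of_frame F₂
  refine Run.mono (Run.forTo (T := n * 50 + 8) (N := n)
    (fun j s' => s'.nReg 4 ≠ 0 ↔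
      ∀ v < j, ∀ x < n, adj v x → s₂.nArr 4 v ≠ 0 ∨ s₂.nArr 4 x ≠ 0)
    hin₂.size (by decide) rfl rfl (by simp) ?_ ?_) le_rfl ?_
  · intro j hj s₃ F₃ hx hI
    have hin₃ : Input n adj g s₃ := ⟨by rw [F₃.nReg 0 rfl]; exact hin₂.size,
      by rw [F₃.nArr 0 rfl]; exact hin₂.adj_iff, by rw [F₃.rArr 0 rfl]; exact hin₂.pref,
      by rw [F₃.nArr 5 rfl]; exact hin₂.off⟩
    have hM₃ : s₃.nArr 4 = s₂.nArr 4 := F₃.nArr 4 rfl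
    refine Run.mono (Run.forTo (T := 40) (N := n)
      (fun i s' => s'.nReg 4 ≠ 0 ↔
        (∀ v < j, ∀ x < n, adj v x → s₂.nArr 4 v ≠ 0 ∨ s₂.nArr 4 x ≠ 0) ∧
        ∀ x < i, adj j x → s₂.nArr 4 j ≠ 0 ∨ s₂.nArr 4 x ≠ 0)
      hin₃.size (by decide) rfl rfl (by simpa using hI) ?_ le_rfl) le_rfl ?_
    · intro i hi s₄ F₄ hy hI'
      have hin₄ := hin₃.of_frame F₄
      have hM₄ : s₄.nArr 4 = s₂.nArr 4 := by rw [F₄.nArr 4 rfl, hM₃]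
      have hx₄ : s₄.nReg 5 = j := by rw [F₄.nReg 5 rfl, hx]
      have hc : BExp.Holds s₄
          (.and (.nle (.const 1) (.get 0 (.add (.get 5 (.reg 5)) (.reg 6))))
          (.and (.nle (.get 4 (.reg 5)) (.const 0)) (.nle (.get 4 (.reg 6)) (.const 0)))) ↔
          adj j i ∧ s₂.nArr 4 j = 0 ∧ s₂.nArr 4 i = 0 := by
        simp [hx₄, hy, hin₄.off j hj, hM₄, hin₄.adj_iff j hj i hi]
      refine Run.ite (T := 2) (fun hb => .straight rfl (by decide) ?_)
        (fun hb => .straight rfl (by decide) ?_) (by decide)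
      · rw [hc] at hb
        refine iff_of_false (by simp) fun h => ?_
        rcases h.2 i (by omega) hb.1 with h | h <;> omega
      · rw [hc] at hb
        simp only [Prog.run, State.setN_nReg, show (4 : ℕ) ≠ 6 by decide, if_false]
        rw [hI']
        refine and_congr_right fun _ => ⟨fun h x hxi hax => ?_, fun h x hxi => h x (by omega)⟩
        rcases Nat.lt_succ_iff_lt_or_eq.mp hxi with hxi | rfl
        · exact h x hxi hax
        · by_contra! hcon
          exact hb ⟨hax, by omega, by omega⟩
    · rintro s₄ ⟨h₄, -⟩
      simp only [State.setN_nReg, show (4 : ℕ) ≠ 5 by decide, if_false]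
      rw [h₄]
      constructor
      · rintro ⟨h, h'⟩ v hv
        rcases Nat.lt_succ_iff_lt_or_eq.mp hv with hv | rfl
        exacts [h v hv, h']
      · exact fun h => ⟨fun v hv => h v (by omega), h j (by omega)⟩
  · have : n * (n * 50 + 8 + 10) = 50 * n ^ 2 + 18 * n := by ring
    omega
  · rintro s₃ ⟨h₃, F₃⟩
    have hM₃ : s₃.nArr 4 = s₂.nArr 4 := F₃.nArr 4 rfl
    rw [hM₃]
    exact ⟨h₂, h₃⟩

/-! ### The Hungarian method -/

/-- The test whether a number is `1`. -/
def BExp.isOne (e : NExp) : BExp := .and (.nle (.const 1) e) (.nle e (.const 1))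

@[simp] theorem BExp.holds_isOne (s : State) (e : NExp) :
    (BExp.isOne e).Holds s ↔ e.eval s = 1 := by
  simp only [BExp.isOne, BExp.Holds, NExp.eval]
  omega

/-- Distinct matrix positions have distinct indices, so writing one weight does not destroy another.
-/
theorem rowMajor_index_inj {n q v q' v' : ℕ} (hv : v < n) (hv' : v' < n)
    (h : q * n + v = q' * n + v') : q = q' ∧ v = v' := by
  have hn : 0 < n := by omega
  have h1 : (v + n * q) / n = (v' + n * q') / n := by
    rw [add_comm, mul_comm, h, add_comm, mul_comm]
  rw [Nat.add_mul_div_left _ _ hn, Nat.add_mul_div_left _ _ hn, Nat.div_eq_of_lt hv,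
    Nat.div_eq_of_lt hv', zero_add, zero_add] at h1
  subst h1
  exact ⟨rfl, by omega⟩

/-- The state holds `n`, row offsets, the weights `w` in array 1, and marks `A` and `M` of the
agents and the seats that take no part in the assignment problem. -/
structure Weighted (n : ℕ) (w : ℕ → ℕ → ℝ) (A M : ℕ → ℕ) (s : State) : Prop where
  size : s.nReg 0 = n
  off : ∀ v < n, s.nArr 5 v = v * n
  weight : ∀ q < n, ∀ v < n, s.rArr 1 (q * n + v) = w q v
  agent : s.nArr 7 = A
  seat : s.nArr 4 = M

theorem Weighted.of_frame {n : ℕ} {w : ℕ → ℕ → ℝ} {A M : ℕ → ℕ} {s s' : State} {c : Prog}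
    (h : Weighted n w A M s) (hF : Frame c s s') (h₀ : c.setsN 0 = false := by rfl)
    (h₁ : c.putsN 4 = false := by rfl) (h₂ : c.putsN 5 = false := by rfl)
    (h₃ : c.putsN 7 = false := by rfl) (h₄ : c.putsR 1 = false := by rfl) :
    Weighted n w A M s' where
  size := by rw [hF.nReg 0 h₀, h.size]
  off := by rw [hF.nArr 5 h₂]; exact h.off
  weight := by rw [hF.rArr 1 h₄]; exact h.weight
  agent := by rw [hF.nArr 7 h₃, h.agent]
  seat := by rw [hF.nArr 4 h₁, h.seat]

section

variable {n : ℕ} {w : ℕ → ℕ → ℝ} {A M p₀ : ℕ → ℕ}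

/-- Find an unmarked column outside the tree with minimum label (array 4): it goes to register 9,
its label to register 0 for reals. -/
def findColumn : Prog :=
  .nSet 9 (.reg 0) ⨟
  .forTo 5 0 (.ite
    (.and (.and (.nle (.get 4 (.reg 5)) (.const 0)) (.not (.isOne (.get 8 (.reg 5)))))
      (.not (.and (.not (.nle (.reg 0) (.reg 9))) (.not (.rle (.get 4 (.reg 5)) (.reg 0))))))
    (.nSet 9 (.reg 5) ⨟ .rSet 0 (.get 4 (.reg 5))) .skip)

/-- The value `n` in register 9 means that no candidate has been met yet; the hypothesis `hex` rules
this out at the end of the scan. -/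
theorem run_findColumn {s : State} (hw : Weighted n w A M s)
    (hex : ∃ v < n, M v = 0 ∧ s.nArr 8 v ≠ 1) :
    Run findColumn s (70 * n + 20) (fun s' => ∃ j, s'.nReg 9 = j ∧ s'.rReg 0 = s.rArr 4 j ∧
      j < n ∧ M j = 0 ∧ s.nArr 8 j ≠ 1 ∧
      ∀ v < n, M v = 0 → s.nArr 8 v ≠ 1 → s.rArr 4 j ≤ s.rArr 4 v) := by
  refine Run.seq (T₁ := 2) (R := fun s' => s' = s.setN 9 n)
    (.straight rfl (by decide) (by simp [hw.size])) (T₂ := 70 * n + 10) ?_ (by omega)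
  rintro _ rfl
  refine Run.mono (Run.forTo (T := 50) (N := n) (fun i s' =>
    (s'.nReg 9 = n ∧ ∀ v < i, M v = 0 → s.nArr 8 v = 1) ∨
    ∃ j < i, s'.nReg 9 = j ∧ s'.rReg 0 = s.rArr 4 j ∧ M j = 0 ∧ s.nArr 8 j ≠ 1 ∧
      ∀ v < i, M v = 0 → s.nArr 8 v ≠ 1 → s.rArr 4 j ≤ s.rArr 4 v)
    (by simp [hw.size]) (by decide) rfl rfl (.inl (by simp)) ?_ le_rfl) (by omega) ?_
  · intro i hi s' hF hx hI
    have hn : s'.nReg 0 = n := by rw [hF.nReg 0 rfl]; simp [hw.size]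
    have h4 : s'.nArr 4 = M := by rw [hF.nArr 4 rfl]; simp [hw.seat]
    have h8 : s'.nArr 8 = s.nArr 8 := by rw [hF.nArr 8 rfl]; simp
    have hr4 : s'.rArr 4 = s.rArr 4 := by rw [hF.rArr 4 rfl]; simp
    refine Run.ite (T := 6) (fun hb => .straight rfl (by decide) ?_)
      (fun hb => .straight rfl (by decide) ?_) (by decide)
    · simp only [BExp.Holds, BExp.holds_isOne, NExp.eval, RExp.eval, hn, hx, h4, h8, hr4] at hb
      obtain ⟨⟨hM, hu⟩, hb⟩ := hb
      refine .inr ⟨i, by omega, by simp [hx], by simp [hx, hr4], by omega, hu, ?_⟩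
      intro v hv hMv huv
      rcases Nat.lt_succ_iff_lt_or_eq.mp hv with hv | rfl
      · rcases hI with ⟨-, hI⟩ | ⟨j, hj, h9, hδ, -, -, hI⟩
        · exact absurd (hI v hv hMv) huv
        · have : s.rArr 4 i ≤ s'.rReg 0 := by
            by_contra hcon
            exact hb ⟨by omega, hcon⟩
          rw [hδ] at this
          exact this.trans (hI v hv hMv huv)
      · exact le_rfl
    · simp only [BExp.Holds, BExp.holds_isOne, NExp.eval, RExp.eval, hn, hx, h4, h8, hr4] at hb
      rcases hI with ⟨h9, hI⟩ | ⟨j, hj, h9, hδ, hMj, huj, hI⟩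
      · refine .inl ⟨by simpa using h9, fun v hv hMv => ?_⟩
        rcases Nat.lt_succ_iff_lt_or_eq.mp hv with hv | rfl
        · exact hI v hv hMv
        · by_contra hcon
          exact hb ⟨⟨by omega, hcon⟩, fun h => h.1 (by omega)⟩
      · refine .inr ⟨j, by omega, by simpa using h9, by simpa using hδ, hMj, huj, ?_⟩
        intro v hv hMv huv
        rcases Nat.lt_succ_iff_lt_or_eq.mp hv with hv | rfl
        · exact hI v hv hMv huv
        · rw [← hδ]
          by_contra hcon
          exact hb ⟨⟨by omega, huv⟩, fun h => h.2 (not_le.mp hcon).le⟩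
  · rintro s' ⟨⟨-, hI⟩ | ⟨j, hj, h9, hδ, hMj, huj, hI⟩, -⟩
    · obtain ⟨v, hv, hMv, huv⟩ := hex
      exact absurd (hI v hv hMv) huv
    · exact ⟨j, h9, hδ, hj, hMj, huj, hI⟩

/-- Change the potentials (arrays 2 and 3) and the labels by the value of register 0 for reals. -/
def changePotentials : Prog :=
  .forTo 5 0
    (.ite (.isOne (.get 9 (.reg 5)))
      (.rPut 2 (.reg 5) (.sub (.get 2 (.reg 5)) (.reg 0))) .skip ⨟
    .ite (.isOne (.get 8 (.reg 5)))
      (.rPut 3 (.reg 5) (.add (.get 3 (.reg 5)) (.reg 0)))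
      (.rPut 4 (.reg 5) (.sub (.get 4 (.reg 5)) (.reg 0))))

theorem run_changePotentials {s : State} {δ : ℝ} (hn : s.nReg 0 = n) (hδ : s.rReg 0 = δ) :
    Run changePotentials s (60 * n + 10) (fun s' =>
      (∀ q < n, s'.rArr 2 q = if s.nArr 9 q = 1 then s.rArr 2 q - δ else s.rArr 2 q) ∧
      (∀ v < n, s'.rArr 3 v = if s.nArr 8 v = 1 then s.rArr 3 v + δ else s.rArr 3 v) ∧
      (∀ v < n, s'.rArr 4 v = if s.nArr 8 v = 1 then s.rArr 4 v else s.rArr 4 v - δ)) := by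
  refine Run.mono (Run.forTo (T := 50) (N := n) (fun i s' =>
    (∀ q, s'.rArr 2 q = if q < i ∧ s.nArr 9 q = 1 then s.rArr 2 q - δ else s.rArr 2 q) ∧
    (∀ v, s'.rArr 3 v = if v < i ∧ s.nArr 8 v = 1 then s.rArr 3 v + δ else s.rArr 3 v) ∧
    (∀ v, s'.rArr 4 v = if v < i ∧ s.nArr 8 v ≠ 1 then s.rArr 4 v - δ else s.rArr 4 v))
    hn (by decide) rfl rfl (by simp) ?_ le_rfl) (by omega) ?_
  · rintro i hi s' hF hx ⟨hI₁, hI₂, hI₃⟩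
    have h8 : s'.nArr 8 = s.nArr 8 := hF.nArr 8 rfl
    have h9 : s'.nArr 9 = s.nArr 9 := hF.nArr 9 rfl
    have h0 : s'.rReg 0 = δ := (hF.rReg 0 rfl).trans hδ
    have hlt : ∀ q, q ≠ i → (q < i + 1 ↔ q < i) := fun q hq => by omega
    refine Run.seq (T₁ := 20) (T₂ := 20) (R := fun s₁ =>
      (∀ q, s₁.rArr 2 q = if q < i + 1 ∧ s.nArr 9 q = 1 then s.rArr 2 q - δ else s.rArr 2 q) ∧
      s₁.rArr 3 = s'.rArr 3 ∧ s₁.rArr 4 = s'.rArr 4 ∧ s₁.nReg 5 = i ∧ s₁.nArr 8 = s.nArr 8 ∧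
      s₁.rReg 0 = δ) ?_ ?_ (by omega)
    · refine Run.ite (T := 8) (fun hb => .straight rfl (by decide) ?_)
        (fun hb => .straight rfl (by decide) ?_) (by decide)
      · simp only [BExp.holds_isOne, NExp.eval, hx, h9] at hb
        refine ⟨fun q => ?_, by simp, by simp, hx, h8, h0⟩
        by_cases hq : q = i
        · subst hq; simp [hx, h0, hb, hI₁]
        · simp [hx, hq, hI₁, hlt q hq]
      · simp only [BExp.holds_isOne, NExp.eval, hx, h9] at hb
        refine ⟨fun q => ?_, by simp, by simp, hx, h8, h0⟩
        by_cases hq : q = i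
        · subst hq; simp [hb, hI₁]
        · simp [hI₁, hlt q hq]
    · rintro s₁ ⟨hJ₁, hJ₂, hJ₃, hx₁, h8₁, h0₁⟩
      refine Run.ite (T := 8) (fun hb => .straight rfl (by decide) ?_)
        (fun hb => .straight rfl (by decide) ?_) (by decide)
      · simp only [BExp.holds_isOne, NExp.eval, hx₁, h8₁] at hb
        refine ⟨by simpa using hJ₁, fun q => ?_, fun q => ?_⟩
        · by_cases hq : q = i
          · subst hq; simp [hx₁, h0₁, hb, hI₂, hJ₂]
          · simp [hx₁, hq, hI₂, hJ₂, hlt q hq]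
        · by_cases hq : q = i
          · subst hq; simp [hb, hI₃, hJ₃]
          · simp [hI₃, hJ₃, hlt q hq]
      · simp only [BExp.holds_isOne, NExp.eval, hx₁, h8₁] at hb
        refine ⟨by simpa using hJ₁, fun q => ?_, fun q => ?_⟩
        · by_cases hq : q = i
          · subst hq; simp [hb, hI₂, hJ₂]
          · simp [hI₂, hJ₂, hlt q hq]
        · by_cases hq : q = i
          · subst hq; simp [hx₁, h0₁, hb, hI₃, hJ₃]
          · simp [hx₁, hq, hI₃, hJ₃, hlt q hq]
  · rintro s' ⟨⟨hI₁, hI₂, hI₃⟩, -⟩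
    refine ⟨fun q hq => by simp [hI₁, hq], fun v hv => by simp [hI₂, hv], fun v hv => ?_⟩
    by_cases h : s.nArr 8 v = 1 <;> simp [hI₃, hv, h]

/-- Add the column in register 8 and its row to the tree (arrays 8 and 9), and update the labels
and parents (array 10) of the other columns. -/
def growTree : Prog :=
  .nPut 8 (.reg 8) (.const 1) ⨟
  .nPut 9 (.get 6 (.reg 8)) (.const 1) ⨟
  .forTo 5 0 (.ite
    (.and (.nle (.get 4 (.reg 5)) (.const 0)) (.not (.isOne (.get 8 (.reg 5)))))
    (.rSet 0 (.sub (.add (.get 2 (.get 6 (.reg 8))) (.get 3 (.reg 5)))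
        (.get 1 (.add (.get 5 (.get 6 (.reg 8))) (.reg 5)))) ⨟
      .ite (.rle (.reg 0) (.get 4 (.reg 5)))
        (.rPut 4 (.reg 5) (.reg 0) ⨟ .nPut 10 (.reg 5) (.reg 8)) .skip)
    .skip)

theorem run_growTree {s : State} {i j : ℕ} {ρ : ℕ → ℕ} (hw : Weighted n w A M s)
    (hP : Partial n w A M p₀ i (s.nArr 6) (s.rArr 2) (s.rArr 3))
    (hT : Tree n w M i (s.nArr 6) (s.rArr 2) (s.rArr 3) (s.nArr 8) (s.nArr 9) (s.nArr 10)
      (s.rArr 4) ρ)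
    (hj : j < n) (h8 : s.nReg 8 = j) (hMj : M j = 0) (huj : s.nArr 8 j ≠ 1)
    (hpj : s.nArr 6 j < n) (hmj : s.rArr 4 j = 0) :
    Run growTree s (80 * n + 20) (fun s' =>
      Tree n w M i (s'.nArr 6) (s'.rArr 2) (s'.rArr 3) (s'.nArr 8) (s'.nArr 9) (s'.nArr 10)
        (s'.rArr 4) (Function.update ρ j (treeSize n (s.nArr 8) + 1)) ∧
      treeSize n (s'.nArr 8) = treeSize n (s.nArr 8) + 1) := by
  refine Run.mono (Run.frame (T := 80 * n + 20) (Q := fun s' =>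
    s'.nArr 8 = Function.update (s.nArr 8) j 1 ∧
    s'.nArr 9 = Function.update (s.nArr 9) (s.nArr 6 j) 1 ∧
    (∀ v < n, M v ≠ 0 ∨ s.nArr 8 v = 1 ∨ v = j → s'.nArr 10 v = s.nArr 10 v) ∧
    (∀ v < n, M v = 0 → s.nArr 8 v ≠ 1 → v ≠ j →
      s.rArr 2 (s.nArr 6 j) + s.rArr 3 v - w (s.nArr 6 j) v ≤ s.rArr 4 v →
      s'.nArr 10 v = j ∧
      s'.rArr 4 v = s.rArr 2 (s.nArr 6 j) + s.rArr 3 v - w (s.nArr 6 j) v) ∧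
    (∀ v < n, M v = 0 → s.nArr 8 v ≠ 1 → v ≠ j →
      ¬ s.rArr 2 (s.nArr 6 j) + s.rArr 3 v - w (s.nArr 6 j) v ≤ s.rArr 4 v →
      s'.nArr 10 v = s.nArr 10 v ∧ s'.rArr 4 v = s.rArr 4 v)) ?_) le_rfl ?_
  · refine Run.seq (T₁ := 3) (T₂ := 80 * n + 16)
      (R := fun s' => s' = s.putN 8 j 1) (.straight rfl (by decide) (by simp [h8])) ?_ (by omega)
    rintro _ rfl
    refine Run.seq (T₁ := 4) (T₂ := 80 * n + 11)
      (R := fun s' => s' = (s.putN 8 j 1).putN 9 (s.nArr 6 j) 1)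
      (.straight rfl (by decide) (by simp [h8])) ?_ (by omega)
    rintro _ rfl
    set s₀ := (s.putN 8 j 1).putN 9 (s.nArr 6 j) 1 with hs₀
    set slack : ℕ → ℝ := fun v => s.rArr 2 (s.nArr 6 j) + s.rArr 3 v - w (s.nArr 6 j) v
      with hslack
    -- The membership test sees the tree mark after its update, so column `j` itself is never
    -- relabelled and keeps its parent.
    set cond : ℕ → Prop := fun v => (M v = 0 ∧ Function.update (s.nArr 8) j 1 v ≠ 1) ∧
      slack v ≤ s.rArr 4 v with hcond
    have hw₀ : Weighted n w A M s₀ := by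
      refine ⟨by simpa [hs₀] using hw.size, ?_, ?_, by simpa [hs₀] using hw.agent,
        by simpa [hs₀] using hw.seat⟩
      · simpa [hs₀] using hw.off
      · simpa [hs₀] using hw.weight
    have h8₀ : s₀.nArr 8 = Function.update (s.nArr 8) j 1 := by simp [hs₀]
    refine Run.mono (Run.forTo (T := 70) (N := n) (fun i s' =>
      (∀ v < i, cond v → s'.nArr 10 v = j ∧ s'.rArr 4 v = slack v) ∧
      ∀ v, (v < i → ¬ cond v) → s'.nArr 10 v = s.nArr 10 v ∧ s'.rArr 4 v = s.rArr 4 v)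
      (by simpa [hs₀] using hw.size) (by decide) rfl rfl
      (by simp [hs₀]) ?_ le_rfl) (by omega) ?_
    · rintro i hi s' hF hx ⟨hI₁, hI₂⟩
      have hw' := hw₀.of_frame hF
      have hu' : s'.nArr 8 = Function.update (s.nArr 8) j 1 := by rw [hF.nArr 8 rfl, h8₀]
      have h6' : s'.nArr 6 = s.nArr 6 := by rw [hF.nArr 6 rfl]; simp [hs₀]
      have hr2 : s'.rArr 2 = s.rArr 2 := by rw [hF.rArr 2 rfl]; simp [hs₀]
      have hr3 : s'.rArr 3 = s.rArr 3 := by rw [hF.rArr 3 rfl]; simp [hs₀]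
      have h8' : s'.nReg 8 = j := by rw [hF.nReg 8 rfl]; simpa [hs₀] using h8
      have h4i := hI₂ i (fun h => absurd h (lt_irrefl i))
      have hskip : ¬ cond i → ∀ s₁ : State, s₁.nArr 10 = s'.nArr 10 → s₁.rArr 4 = s'.rArr 4 →
          (∀ v < i + 1, cond v → s₁.nArr 10 v = j ∧ s₁.rArr 4 v = slack v) ∧
          ∀ v, (v < i + 1 → ¬ cond v) →
            s₁.nArr 10 v = s.nArr 10 v ∧ s₁.rArr 4 v = s.rArr 4 v := by
        intro hc s₁ h1 h2
        rw [h1, h2]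
        refine ⟨fun v hv hcv => ?_, fun v hv => hI₂ v fun h => hv (by omega)⟩
        have hvi : v ≠ i := by rintro rfl; exact hc hcv
        exact hI₁ v (by omega) hcv
      refine Run.ite (T := 45) (fun hb => ?_) (fun hb => .straight rfl (by decide) ?_) (by decide)
      · simp only [BExp.Holds, BExp.holds_isOne, NExp.eval, hx, hu', hw'.seat, Nat.le_zero] at hb
        refine Run.seq (T₁ := 20) (T₂ := 15) (R := fun s₁ => s₁ = s'.setR 0 (slack i))
          (.straight rfl (by decide) ?_) ?_ (by omega)
        · simp only [Prog.run, RExp.eval, NExp.eval, h8', h6', hr2, hr3, hx, hw'.off _ hpj,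
            hw'.weight _ hpj i hi, hslack]
        · rintro _ rfl
          refine Run.ite (T := 8) (fun hb' => .straight rfl (by decide) ?_)
            (fun hb' => .straight rfl (by decide) ?_) (by decide)
          · simp only [BExp.Holds, RExp.eval, NExp.eval, State.setR_rReg, if_true, State.setR_rArr,
              State.setR_nReg, hx, h4i.2] at hb'
            refine ⟨fun v hv hcv => ?_, fun v hv => ?_⟩
            · by_cases hvi : v = i
              · simp [hvi, hx, h8']
              · simpa [hvi, hx] using hI₁ v (by omega) hcv
            · have hvi : v ≠ i := by rintro rfl; exact hv (by omega) ⟨hb, hb'⟩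
              simpa [hvi, hx] using hI₂ v fun h => hv (by omega)
          · simp only [BExp.Holds, RExp.eval, NExp.eval, State.setR_rReg, if_true, State.setR_rArr,
              State.setR_nReg, hx, h4i.2] at hb'
            exact hskip (fun hc => hb' hc.2) _ (by simp) (by simp)
      · simp only [BExp.Holds, BExp.holds_isOne, NExp.eval, hx, hu', hw'.seat, Nat.le_zero] at hb
        exact hskip (fun hc => hb hc.1) _ (by simp) (by simp)
    · rintro s' ⟨⟨hI₁, hI₂⟩, hF⟩
      refine ⟨by rw [hF.nArr 8 rfl, h8₀], by rw [hF.nArr 9 rfl]; simp [hs₀], ?_, ?_, ?_⟩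
      · intro v hv hor
        refine (hI₂ v fun _ hc => ?_).1
        rcases hor with h | h | h
        · exact h hc.1.1
        · by_cases hvj : v = j
          · exact hc.1.2 (by simp [hvj])
          · exact hc.1.2 (by simpa [hvj] using h)
        · exact hc.1.2 (by simp [h])
      · intro v hv hM hu hvj hle
        exact hI₁ v hv ⟨⟨hM, by simpa [hvj] using hu⟩, hle⟩
      · intro v hv hM hu hvj hle
        exact hI₂ v fun _ hc => hle hc.2
  · rintro s' ⟨⟨h8', h9', hout, hlt, hge⟩, hF⟩
    rw [hF.nArr 6 rfl, hF.rArr 2 rfl, hF.rArr 3 rfl, h8', h9']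
    exact ⟨hT.grow hP hj hMj huj hpj hmj hout hlt hge, treeSize_update hj huj⟩

/-- Grow the tree until it reaches a free column, which goes to register 8. -/
def buildTree : Prog :=
  .while (.nle (.reg 10) (.const 0))
    (findColumn ⨟ changePotentials ⨟ .nSet 8 (.reg 9) ⨟
      .ite (.nle (.reg 0) (.get 6 (.reg 8))) (.nSet 10 (.const 1)) growTree)

/-- Every round either meets a free column and stops or adds a column to the tree. A tree has at
most `n` columns, so there are at most `n + 1` rounds, of O(n) steps each. -/
theorem run_buildTree {s : State} {i : ℕ} (hi : i < n) (hA : A i = 0) (hw : Weighted n w A M s)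
    (hP : Partial n w A M p₀ i (s.nArr 6) (s.rArr 2) (s.rArr 3))
    (hT : Tree n w M i (s.nArr 6) (s.rArr 2) (s.rArr 3) (s.nArr 8) (s.nArr 9) (s.nArr 10)
      (s.rArr 4) (fun _ => 0)) (h10 : s.nReg 10 = 0) :
    Run buildTree s (700 * n ^ 2) (fun s' => ∃ ρ j,
      Partial n w A M p₀ i (s'.nArr 6) (s'.rArr 2) (s'.rArr 3) ∧
      Tree n w M i (s'.nArr 6) (s'.rArr 2) (s'.rArr 3) (s'.nArr 8) (s'.nArr 9) (s'.nArr 10)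
        (s'.rArr 4) ρ ∧
      s'.nReg 8 = j ∧ j < n ∧ M j = 0 ∧ s'.nArr 8 j ≠ 1 ∧ s'.nArr 6 j = n ∧ s'.rArr 4 j = 0) := by
  refine Run.mono (Run.while (K := n + 1) (T := 210 * n + 80) (fun k s' => ∃ ρ,
    Partial n w A M p₀ i (s'.nArr 6) (s'.rArr 2) (s'.rArr 3) ∧
    Tree n w M i (s'.nArr 6) (s'.rArr 2) (s'.rArr 3) (s'.nArr 8) (s'.nArr 9) (s'.nArr 10)
      (s'.rArr 4) ρ ∧
    (s'.nReg 10 = 0 → n + 1 ≤ k + treeSize n (s'.nArr 8)) ∧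
    (s'.nReg 10 ≠ 0 → ∃ j, s'.nReg 8 = j ∧ j < n ∧ M j = 0 ∧ s'.nArr 8 j ≠ 1 ∧
      s'.nArr 6 j = n ∧ s'.rArr 4 j = 0))
    ⟨_, hP, hT, fun _ => by omega, fun h => absurd h10 h⟩ ?_ le_rfl) ?_ ?_
  · rintro k s₁ F₁ ⟨ρ, hP₁, hT₁, hk, -⟩ hb
    have hw₁ := hw.of_frame F₁
    simp only [BExp.Holds, NExp.eval, Nat.le_zero] at hb
    refine Run.seq (T₂ := 140 * n + 55)
      (run_findColumn hw₁ (hT₁.exists_unused hP₁ hi hA)).frame ?_ (by omega)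
    rintro s₂ ⟨⟨j, h9, hδ, hj, hMj, huj, hmin⟩, F₂⟩
    have hw₂ := hw₁.of_frame F₂
    refine Run.seq (T₂ := 80 * n + 40) (run_changePotentials hw₂.size hδ).frame ?_ (by omega)
    rintro s₃ ⟨⟨hu, hy, hm⟩, F₃⟩
    have hw₃ := hw₂.of_frame F₃
    have e6 : s₃.nArr 6 = s₁.nArr 6 := by rw [F₃.nArr 6 rfl, F₂.nArr 6 rfl]
    have e8 : s₃.nArr 8 = s₁.nArr 8 := by rw [F₃.nArr 8 rfl, F₂.nArr 8 rfl]
    have e9 : s₃.nArr 9 = s₁.nArr 9 := by rw [F₃.nArr 9 rfl, F₂.nArr 9 rfl]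
    have e10 : s₃.nArr 10 = s₁.nArr 10 := by rw [F₃.nArr 10 rfl, F₂.nArr 10 rfl]
    rw [F₂.nArr 9 rfl, F₂.rArr 2 rfl] at hu
    rw [F₂.nArr 8 rfl, F₂.rArr 3 rfl] at hy
    rw [F₂.nArr 8 rfl, F₂.rArr 4 rfl] at hm
    obtain ⟨hP₃, hT₃, hm₃⟩ := hT₁.update hP₁ hi hA hj hMj huj hmin hu hy hm
    refine Run.seq (T₁ := 2) (T₂ := 80 * n + 30) (R := fun s' => s' = s₃.setN 8 j)
      (.straight rfl (by decide) (by simp [F₃.nReg 9 rfl, h9])) ?_ (by omega)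
    rintro _ rfl
    refine Run.ite (T := 80 * n + 20) ?_ ?_ (by simp only [BExp.cost, NExp.cost]; omega)
    · intro hb'
      simp only [BExp.Holds, NExp.eval, State.setN_nReg, State.setN_nArr, if_true, hw₃.size, e6,
        show (0 : ℕ) ≠ 8 by decide, if_false] at hb'
      refine .straight rfl ((by decide : _ ≤ 2).trans (by omega))
        ⟨k - 1, ?_, ρ, ?_, ?_, ?_, ?_⟩
      · have := treeSize_le (n := n) (used := s₁.nArr 8)
        have := hk hb
        omega
      · simpa [e6] using hP₃
      · simpa [e6, e8, e9, e10] using hT₃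
      · simp
      · refine fun _ => ⟨j, by simp, hj, hMj, by simpa [e8] using huj, ?_, by simpa using hm₃⟩
        have := hP₁.le j hj
        simp only [Prog.run, State.setN_nArr, e6]
        omega
    · intro hb'
      simp only [BExp.Holds, NExp.eval, State.setN_nReg, State.setN_nArr, if_true, hw₃.size, e6,
        show (0 : ℕ) ≠ 8 by decide, if_false] at hb'
      have hw₄ : Weighted n w A M (s₃.setN 8 j) :=
        ⟨by simpa using hw₃.size, hw₃.off, hw₃.weight, hw₃.agent, hw₃.seat⟩
      have hP₄ : Partial n w A M p₀ i ((s₃.setN 8 j).nArr 6) ((s₃.setN 8 j).rArr 2)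
          ((s₃.setN 8 j).rArr 3) := by simpa [e6] using hP₃
      refine Run.mono (run_growTree hw₄ hP₄ (i := i) (j := j) (ρ := ρ)
        (by simpa [e6, e8, e9, e10] using hT₃) hj (by simp) hMj (by simpa [e8] using huj)
        (by simpa [e6] using hb') (by simpa using hm₃)).frame le_rfl ?_
      rintro s₅ ⟨⟨hT₅, hsize⟩, F₅⟩
      have hkk := hk hb
      have h10' : s₅.nReg 10 = 0 := by
        rw [F₅.nReg 10 rfl]
        simp [F₃.nReg 10 rfl, F₂.nReg 10 rfl, hb]
      have := treeSize_le (n := n) (used := s₁.nArr 8)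
      refine ⟨k - 1, by omega, _, ?_, hT₅, ?_, fun h => absurd h10' h⟩
      · rw [F₅.nArr 6 rfl, F₅.rArr 2 rfl, F₅.rArr 3 rfl]
        exact hP₄
      · intro _
        rw [hsize]
        simp only [State.setN_nArr, e8]
        omega
  · simp only [BExp.cost, NExp.cost]
    have : (n + 1) * (210 * n + 80 + (1 + 1 + 1) + 1) = 210 * n ^ 2 + 294 * n + 84 := by ring
    have : n ≤ n ^ 2 := Nat.le_self_pow (by norm_num) n
    omega
  · rintro s' ⟨⟨k, ρ, hP', hT', -, h⟩, hb, -⟩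
    simp only [BExp.Holds, NExp.eval, Nat.le_zero] at hb
    obtain ⟨j, hj⟩ := h hb
    exact ⟨ρ, j, hP', hT', hj⟩

/-- Move the agents along the path of the tree that ends at the column in register 8. -/
def movePath : Prog :=
  .while (.nle (.add (.reg 8) (.const 1)) (.reg 0))
    (.nPut 6 (.reg 8) (.get 6 (.get 10 (.reg 8))) ⨟ .nSet 8 (.get 10 (.reg 8)))

/-- The rank of the hole serves as the measure; it starts at no more than `n + 1` and falls with
every move. -/
theorem run_movePath {s : State} {i j : ℕ} {ρ : ℕ → ℕ} {S : ℕ → Prop} {p₁ : ℕ → ℕ}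
    (hn : s.nReg 0 = n) (h8 : s.nReg 8 = j) (hρ : ρ j ≤ n + 1)
    (h : Augment n w A M p₀ i (s.rArr 2) (s.rArr 3) (s.nArr 10) ρ S p₁ (s.nArr 6) j) :
    Run movePath s (20 * n + 30) (fun s' =>
      Augment n w A M p₀ i (s.rArr 2) (s.rArr 3) (s.nArr 10) ρ S p₁ (s'.nArr 6) n) := by
  refine Run.mono (Run.while (K := n + 1) (T := 9) (fun k s' =>
    ρ (s'.nReg 8) ≤ k ∧ Augment n w A M p₀ i (s.rArr 2) (s.rArr 3) (s.nArr 10) ρ S p₁ (s'.nArr 6)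
      (s'.nReg 8)) ⟨by rw [h8]; exact hρ, by rw [h8]; exact h⟩ ?_ le_rfl)
      (by simp only [BExp.cost, NExp.cost]; omega) ?_
  · rintro k s' hF ⟨hk, hI⟩ hb
    have hn' : s'.nReg 0 = n := (hF.nReg 0 rfl).trans hn
    have h10 : s'.nArr 10 = s.nArr 10 := hF.nArr 10 rfl
    simp only [BExp.Holds, NExp.eval, hn'] at hb
    obtain ⟨hI', hr⟩ := hI.step hb
    exact .straight rfl (by decide) ⟨_, hr.trans_le hk, by simp [h10], by simpa [h10] using hI'⟩
  · rintro s' ⟨⟨k, -, hI⟩, hb, hF⟩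
    have hn' : s'.nReg 0 = n := (hF.nReg 0 rfl).trans hn
    simp only [BExp.Holds, NExp.eval, hn'] at hb
    have : s'.nReg 8 = n := hI.hole.resolve_right fun h => hb h.1
    rwa [this] at hI

/-- Start a tree at the agent in register 7. -/
def startTree : Prog :=
  .nPut 6 (.reg 0) (.reg 7) ⨟
  .nSet 10 (.const 0) ⨟
  .forTo 5 0
    (.nPut 8 (.reg 5) (.const 0) ⨟ .nPut 9 (.reg 5) (.const 0) ⨟ .nPut 10 (.reg 5) (.reg 0) ⨟
      .rPut 4 (.reg 5) (.sub (.add (.get 2 (.reg 7)) (.get 3 (.reg 5)))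
        (.get 1 (.add (.get 5 (.reg 7)) (.reg 5))))) ⨟
  .nPut 9 (.reg 7) (.const 1)

theorem run_startTree {s : State} {i : ℕ} (hi : i < n) (hw : Weighted n w A M s)
    (h7 : s.nReg 7 = i) (hP : Partial n w A M p₀ i (s.nArr 6) (s.rArr 2) (s.rArr 3)) :
    Run startTree s (50 * n + 30) (fun s' =>
      Partial n w A M p₀ i (s'.nArr 6) (s'.rArr 2) (s'.rArr 3) ∧
      Tree n w M i (s'.nArr 6) (s'.rArr 2) (s'.rArr 3) (s'.nArr 8) (s'.nArr 9) (s'.nArr 10)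
        (s'.rArr 4) (fun _ => 0) ∧ s'.nReg 10 = 0) := by
  refine Run.seq (T₁ := 3) (T₂ := 50 * n + 24) (R := fun s' => s' = s.putN 6 n i)
    (.straight rfl (by decide) (by simp [hw.size, h7])) ?_ (by omega)
  rintro _ rfl
  refine Run.seq (T₁ := 2) (T₂ := 50 * n + 20) (R := fun s' => s' = (s.putN 6 n i).setN 10 0)
    (.straight rfl (by decide) (by simp)) ?_ (by omega)
  rintro _ rfl
  set s₀ := (s.putN 6 n i).setN 10 0 with hs₀
  have hw₀ : Weighted n w A M s₀ := by
    refine ⟨by simpa [hs₀] using hw.size, ?_, ?_, by simpa [hs₀] using hw.agent,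
      by simpa [hs₀] using hw.seat⟩
    · simpa [hs₀] using hw.off
    · simpa [hs₀] using hw.weight
  have h7₀ : s₀.nReg 7 = i := by simpa [hs₀] using h7
  refine Run.seq (T₂ := 5) (Run.forTo (T := 30) (N := n) (fun k s' =>
    ∀ v < k, s'.nArr 8 v = 0 ∧ s'.nArr 9 v = 0 ∧ s'.nArr 10 v = n ∧
      s'.rArr 4 v = s.rArr 2 i + s.rArr 3 v - w i v)
    hw₀.size (by decide) rfl rfl (by simp) ?_ le_rfl) ?_ (by omega)
  · intro k hk s' hF hx hI
    have hw' := hw₀.of_frame hF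
    have hr2 : s'.rArr 2 = s.rArr 2 := by rw [hF.rArr 2 rfl]; simp [hs₀]
    have hr3 : s'.rArr 3 = s.rArr 3 := by rw [hF.rArr 3 rfl]; simp [hs₀]
    have h7' : s'.nReg 7 = i := (hF.nReg 7 rfl).trans h7₀
    refine .straight rfl (by decide) fun v hv => ?_
    by_cases hvk : v = k
    · subst hvk
      simp [hx, hw'.size, h7', hr2, hr3, hw'.off i hi, hw'.weight i hi v hk]
    · simpa [hx, hvk] using hI v (by omega)
  · rintro s₁ ⟨hI, F₁⟩
    have h7₁ : s₁.nReg 7 = i := (F₁.nReg 7 rfl).trans h7₀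
    have h6₁ : s₁.nArr 6 = Function.update (s.nArr 6) n i := by rw [F₁.nArr 6 rfl]; simp [hs₀]
    have hr2 : s₁.rArr 2 = s.rArr 2 := by rw [F₁.rArr 2 rfl]; simp [hs₀]
    have hr3 : s₁.rArr 3 = s.rArr 3 := by rw [F₁.rArr 3 rfl]; simp [hs₀]
    refine .straight rfl (by decide) ⟨?_, ?_, ?_⟩
    · simp only [Prog.run, State.putN_nArr, State.putN_rArr, h6₁, hr2, hr3,
        show (6 : ℕ) ≠ 9 by decide, if_false]
      -- Writing the root into entry `n` does not affect the seating of the real seats.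
      exact hP.congr (fun v hv => Function.update_of_ne hv.ne _ _) (fun _ _ => rfl)
        fun _ _ => rfl
    · apply Tree.init hi
      · simp [h6₁]
      · intro v hv
        simpa using (hI v hv).1
      · intro q hq
        by_cases hqi : q = i
        · simp [hqi, h7₁]
        · simpa [hqi, h7₁] using (hI q hq).2.1
      · intro v hv
        simpa using (hI v hv).2.2.1
      · intro v hv
        simpa [hr2, hr3] using (hI v hv).2.2.2
    · simp [F₁.nReg 10 rfl, hs₀]

/-- Seat all unmarked agents on the unmarked seats, at maximum weight. -/
def hungarian : Prog :=
  .forTo 7 0 (.ite (.nle (.get 7 (.reg 7)) (.const 0))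
    (startTree ⨟ buildTree ⨟ movePath) .skip)

/-- One round per agent, of O(n²) steps each. Marked agents are skipped, since the tuple has already
seated them. -/
theorem run_hungarian {s : State} (hn : 1 ≤ n) (hw : Weighted n w A M s)
    (hP : Partial n w A M p₀ 0 (s.nArr 6) (s.rArr 2) (s.rArr 3)) :
    Run hungarian s (1000 * n ^ 3) (fun s' =>
      Partial n w A M p₀ n (s'.nArr 6) (s'.rArr 2) (s'.rArr 3)) := by
  have hnn : n ≤ n ^ 2 := Nat.le_self_pow (by norm_num) n
  refine Run.mono (Run.forTo (T := 900 * n ^ 2) (N := n) (fun i s' =>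
    Partial n w A M p₀ i (s'.nArr 6) (s'.rArr 2) (s'.rArr 3)) hw.size (by decide) rfl rfl
    (by simpa using hP) ?_ le_rfl) ?_ fun s' h => h.1
  · intro i hi s₁ F₁ hx hI
    have hw₁ := hw.of_frame F₁
    refine Run.ite (T := 890 * n ^ 2) ?_ ?_ (by simp only [BExp.cost, NExp.cost]; omega)
    · intro hb
      simp only [BExp.Holds, NExp.eval, hx, hw₁.agent, Nat.le_zero] at hb
      refine Run.seq (T₂ := 760 * n ^ 2) (run_startTree hi hw₁ hx hI).frame ?_ (by omega)
      rintro s₂ ⟨⟨hP₂, hT₂, h10⟩, F₂⟩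
      have hw₂ := hw₁.of_frame F₂
      refine Run.seq (run_buildTree hi hb hw₂ hP₂ hT₂ h10).frame (T₂ := 50 * n ^ 2) ?_ (by omega)
      rintro s₃ ⟨⟨ρ, j, hP₃, hT₃, h8, hj, hMj, huj, hpj, hmj⟩, F₃⟩
      have hw₃ := hw₂.of_frame F₃
      have hsize := treeSize_le (n := n) (used := s₃.nArr 8)
      refine Run.mono (run_movePath hw₃.size h8 (by simpa using hsize)
        (hT₃.augment hP₃ hi hb hj hMj huj hpj hmj)).frame (by omega) ?_
      rintro s₄ ⟨hA₄, F₄⟩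
      rw [← F₄.rArr 2 rfl, ← F₄.rArr 3 rfl] at hA₄ hP₃
      simpa using hA₄.done hP₃.feas
    · intro hb
      simp only [BExp.Holds, NExp.eval, hx, hw₁.agent, Nat.le_zero] at hb
      exact .straight rfl ((by decide : _ ≤ 1).trans (by omega)) (by simpa using hI.skip hb)
  · have : n * (900 * n ^ 2 + 10) = 900 * n ^ 3 + 10 * n := by ring
    have : n ≤ n ^ 3 := Nat.le_self_pow (by norm_num) n
    omega

end

section

variable {n : ℕ} {adj : ℕ → ℕ → Prop} {g : ℕ → ℕ → ℝ}

/-! ### The seats of the other agents, for given agents on the vertex cover -/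

/-- Compute the weights of the assignment problem (array 1) and the first potentials. -/
def setWeights : Prog :=
  .forTo 5 0
    (.rPut 2 (.reg 5) .zero ⨟ .rPut 3 (.reg 5) .zero ⨟
    .forTo 6 0
      (.rSet 0 .zero ⨟
      .forTo 12 0 (.ite
        (.and (.nle (.const 1) (.get 0 (.add (.get 5 (.reg 6)) (.reg 12))))
          (.not (.nle (.get 4 (.reg 12)) (.const 0))))
        (.rSet 0 (.add (.reg 0)
          (.add (.get 0 (.add (.get 5 (.reg 5)) (.get 6 (.reg 12))))
            (.get 0 (.add (.get 5 (.get 6 (.reg 12))) (.reg 5)))))) .skip) ⨟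
      .rPut 1 (.add (.get 5 (.reg 5)) (.reg 6)) (.reg 0) ⨟
      .ite (.rle (.get 2 (.reg 5)) (.reg 0)) (.rPut 2 (.reg 5) (.reg 0)) .skip))

/-- With `y = 0`, any `u q` that bounds all weights of agent `q` is feasible. The running maximum
starts at 0, which is harmless because only an upper bound is needed. -/
theorem run_setWeights {s : State} {M p : ℕ → ℕ} (hn : 1 ≤ n) (hin : Input n adj g s)
    (hM : s.nArr 4 = M) (hp : s.nArr 6 = p) (hpn : ∀ x < n, M x ≠ 0 → p x < n) :
    Run setWeights s (200 * n ^ 3) (fun s' =>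
      (∀ q < n, ∀ v < n, s'.rArr 1 (q * n + v) = seatWeight n adj g M p q v ∧
        seatWeight n adj g M p q v ≤ s'.rArr 2 q) ∧ ∀ v < n, s'.rArr 3 v = 0) := by
  refine Run.mono (Run.forTo (T := n * (n * 60 + 60) + 30) (N := n) (fun j s' =>
    (∀ q < j, ∀ v < n, s'.rArr 1 (q * n + v) = seatWeight n adj g M p q v ∧
        seatWeight n adj g M p q v ≤ s'.rArr 2 q) ∧ ∀ v < j, s'.rArr 3 v = 0)
    hin.size (by decide) rfl rfl (by simp) ?_ le_rfl) ?_ fun s' h => h.1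
  · rintro j hj s₁ F₁ hx ⟨hI₁, hI₂⟩
    have hin₁ : Input n adj g s₁ := hin.of_frame F₁
    have hM₁ : s₁.nArr 4 = M := (F₁.nArr 4 rfl).trans hM
    have hp₁ : s₁.nArr 6 = p := (F₁.nArr 6 rfl).trans hp
    refine Run.seq (T₁ := 3) (T₂ := n * (n * 60 + 60) + 20) (R := fun s' => s' = s₁.putR 2 j 0)
      (.straight rfl (by decide) (by simp [hx])) ?_ (by omega)
    rintro _ rfl
    refine Run.seq (T₁ := 3) (T₂ := n * (n * 60 + 60) + 10)
      (R := fun s' => s' = (s₁.putR 2 j 0).putR 3 j 0)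
      (.straight rfl (by decide) (by simp [hx])) ?_ (by omega)
    rintro _ rfl
    set s₂ := (s₁.putR 2 j 0).putR 3 j 0 with hs₂
    have hin₂ : Input n adj g s₂ := by
      refine ⟨by simpa [hs₂] using hin₁.size, ?_, ?_, ?_⟩
      · simpa [hs₂] using hin₁.adj_iff
      · simpa [hs₂] using hin₁.pref
      · simpa [hs₂] using hin₁.off
    refine Run.mono (Run.forTo (T := n * 60 + 50) (N := n) (fun i s' =>
      (∀ q < j, ∀ v < n, s'.rArr 1 (q * n + v) = seatWeight n adj g M p q v ∧
        seatWeight n adj g M p q v ≤ s'.rArr 2 q) ∧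
      ∀ v < i, s'.rArr 1 (j * n + v) = seatWeight n adj g M p j v ∧
        seatWeight n adj g M p j v ≤ s'.rArr 2 j)
      hin₂.size (by decide) rfl rfl ⟨?_, by simp⟩ ?_ le_rfl)
      (by rw [show n * 60 + 50 + 10 = n * 60 + 60 from rfl]; omega) ?_
    · intro q hq v hv
      simpa [hs₂, hq.ne] using hI₁ q hq v hv
    · rintro i hi s₃ F₃ hy ⟨hJ₁, hJ₂⟩
      have hin₃ : Input n adj g s₃ := hin₂.of_frame F₃
      have hM₃ : s₃.nArr 4 = M := by rw [F₃.nArr 4 rfl]; simp [hs₂, hM₁]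
      have hp₃ : s₃.nArr 6 = p := by rw [F₃.nArr 6 rfl]; simp [hs₂, hp₁]
      have hx₃ : s₃.nReg 5 = j := by rw [F₃.nReg 5 rfl]; simp [hs₂, hx]
      refine Run.seq (T₁ := 2) (T₂ := n * 60 + 40) (R := fun s' => s' = s₃.setR 0 0)
        (.straight rfl (by decide) (by simp)) ?_ (by omega)
      rintro _ rfl
      have hin₃' : Input n adj g (s₃.setR 0 0) :=
        ⟨hin₃.size, hin₃.adj_iff, hin₃.pref, hin₃.off⟩
      refine Run.seq (T₁ := n * 60 + 8) (T₂ := 30) (Run.forTo (T := 50) (N := n) (fun l s' =>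
        open Classical in s'.rReg 0 = ∑ x ∈ Finset.range l,
          if adj i x ∧ M x ≠ 0 then g j (p x) + g (p x) j else 0)
        hin₃'.size (by decide) rfl rfl (by simp) ?_ le_rfl) ?_ (by omega)
      · intro l hl s₄ F₄ hz hacc
        have hin₄ : Input n adj g s₄ := hin₃'.of_frame F₄
        have hM₄ : s₄.nArr 4 = M := (F₄.nArr 4 rfl).trans hM₃
        have hp₄ : s₄.nArr 6 = p := (F₄.nArr 6 rfl).trans hp₃
        have hx₄ : s₄.nReg 5 = j := (F₄.nReg 5 rfl).trans hx₃
        have hy₄ : s₄.nReg 6 = i := (F₄.nReg 6 rfl).trans hy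
        refine Run.ite (T := 20) (fun hb => .straight rfl (by decide) ?_)
          (fun hb => .straight rfl (by decide) ?_) (by decide)
        · simp only [BExp.Holds, NExp.eval, hz, hy₄, hin₄.off i hi, hin₄.adj_iff i hi l hl, hM₄,
            Nat.le_zero] at hb
          have hpl := hpn l hl hb.2
          simp only [Prog.run, RExp.eval, NExp.eval, hx₄, hz, hp₄, hin₄.off j hj,
            hin₄.off _ hpl, hin₄.pref j hj _ hpl, hin₄.pref _ hpl j hj, State.setN_rReg,
            State.setR_rReg, if_true, Finset.sum_range_succ, hacc]
          rw [if_pos (show adj i l ∧ M l ≠ 0 from hb)]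
        · simp only [BExp.Holds, NExp.eval, hz, hy₄, hin₄.off i hi, hin₄.adj_iff i hi l hl, hM₄,
            Nat.le_zero] at hb
          simp only [Prog.run, State.setN_rReg, Finset.sum_range_succ, hacc]
          rw [if_neg (show ¬ (adj i l ∧ M l ≠ 0) from hb), add_zero]
      · rintro s₄ ⟨hacc, F₄⟩
        have hin₄ : Input n adj g s₄ := hin₃'.of_frame F₄
        have hx₄ : s₄.nReg 5 = j := (F₄.nReg 5 rfl).trans hx₃
        have hy₄ : s₄.nReg 6 = i := (F₄.nReg 6 rfl).trans hy
        have h1₄ : s₄.rArr 1 = s₃.rArr 1 := F₄.rArr 1 rfl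
        have h2₄ : s₄.rArr 2 = s₃.rArr 2 := F₄.rArr 2 rfl
        replace hacc : s₄.rReg 0 = seatWeight n adj g M p j i := hacc
        refine Run.seq (T₁ := 10) (T₂ := 15)
          (R := fun s' => s' = s₄.putR 1 (j * n + i) (seatWeight n adj g M p j i))
          (.straight rfl (by decide) ?_) ?_ (by omega)
        · simp only [Prog.run, RExp.eval, NExp.eval, hx₄, hy₄, hin₄.off j hj, hacc]
        · rintro _ rfl
          have hW : ∀ q ≤ j, ∀ v < n, (q < j ∨ v < i) →
              Function.update (s₃.rArr 1) (j * n + i) (seatWeight n adj g M p j i) (q * n + v) =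
              s₃.rArr 1 (q * n + v) := by
            intro q hq v hv hor
            rw [Function.update_of_ne]
            intro he
            obtain ⟨h1, h2⟩ := rowMajor_index_inj hv hi he
            omega
          refine Run.ite (T := 8) (fun hb => .straight rfl (by decide) ⟨?_, ?_⟩)
            (fun hb => .straight rfl (by decide) ⟨?_, ?_⟩) (by decide)
          · intro q hq v hv
            have := hJ₁ q hq v hv
            simpa [hx₄, hacc, h1₄, h2₄, hq.ne, hW q hq.le v hv (.inl hq)] using this
          · simp only [BExp.Holds, RExp.eval, NExp.eval, State.putR_rArr, State.putR_nReg,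
              State.putR_rReg, hx₄, hacc, h2₄, show (2 : ℕ) ≠ 1 by decide, if_false] at hb
            intro v hv
            rcases Nat.lt_succ_iff_lt_or_eq.mp hv with hv | rfl
            · obtain ⟨h1, h2⟩ := hJ₂ v hv
              have := hW j le_rfl v (by omega) (.inr hv)
              simp only [Prog.run, RExp.eval, NExp.eval, State.setN_rArr, State.putR_rArr,
                State.putR_nReg, State.putR_rReg, hx₄, hacc, h1₄, if_true, Function.update_self,
                show (1 : ℕ) ≠ 2 by decide, if_false, this]
              exact ⟨h1, h2.trans hb⟩
            · simp [hx₄, hacc]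
          · intro q hq v hv
            have := hJ₁ q hq v hv
            simpa [h1₄, h2₄, hW q hq.le v hv (.inl hq)] using this
          · simp only [BExp.Holds, RExp.eval, NExp.eval, State.putR_rArr, State.putR_nReg,
              State.putR_rReg, hx₄, hacc, h2₄, show (2 : ℕ) ≠ 1 by decide, if_false] at hb
            intro v hv
            rcases Nat.lt_succ_iff_lt_or_eq.mp hv with hv | rfl
            · have := hJ₂ v hv
              simpa [h1₄, h2₄, hW j le_rfl v (by omega) (.inr hv)] using this
            · simpa [h2₄] using (not_le.mp hb).le
    · rintro s₃ ⟨⟨hJ₁, hJ₂⟩, F₃⟩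
      refine ⟨fun q hq v hv => ?_, fun v hv => ?_⟩
      · rcases Nat.lt_succ_iff_lt_or_eq.mp hq with hq | rfl
        · simpa using hJ₁ q hq v hv
        · simpa using hJ₂ v hv
      · simp only [State.setN_rArr, F₃.rArr 3 rfl]
        by_cases hvj : v = j
        · simp [hs₂, hvj]
        · simpa [hs₂, hvj] using hI₂ v (by omega)
  · have : n * (n * (n * 60 + 60) + 30 + 10) = 60 * n ^ 3 + 60 * n ^ 2 + 40 * n := by ring
    have : n ≤ n ^ 3 := Nat.le_self_pow (by norm_num) n
    have : n ^ 2 ≤ n ^ 3 := Nat.pow_le_pow_right hn (by norm_num)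
    omega

/-- Seat the agents of the current tuple (array 2) on the vertex cover (array 3), if they are
distinct; register 4 tells whether they are. -/
def placeTuple : Prog :=
  .forTo 5 0 (.nPut 6 (.reg 5) (.reg 0) ⨟ .nPut 7 (.reg 5) (.const 0)) ⨟
  .nSet 4 (.const 1) ⨟
  .forTo 5 3 (.ite (.nle (.get 7 (.get 2 (.reg 5))) (.const 0))
    (.nPut 7 (.get 2 (.reg 5)) (.const 1) ⨟ .nPut 6 (.get 3 (.reg 5)) (.get 2 (.reg 5)))
    (.nSet 4 (.const 0)))

/-- The first `k` agents of the tuple `D` are distinct, and sit on the seats of the tuple `C`; they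
are marked in `A`, and all other seats are free. -/
structure Placed (n : ℕ) (C D : ℕ → ℕ) (k : ℕ) (A p : ℕ → ℕ) : Prop where
  inj : ∀ t < k, ∀ t' < k, D t = D t' → t = t'
  seated : ∀ t < k, p (C t) = D t
  free : ∀ v < n, (∀ t < k, C t ≠ v) → p v = n
  mark : ∀ q < n, A q ≠ 0 ↔ ∃ t < k, D t = q

/-- An agent that is already marked when its turn comes is a repetition. The loop runs on after a
failure, but the claim about the placement is then vacuous. -/
theorem run_placeTuple {s : State} {γ : ℕ} {C D : ℕ → ℕ} (hn : s.nReg 0 = n) (h3 : s.nReg 3 = γ)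
    (hC : s.nArr 3 = C) (hD : s.nArr 2 = D) (hγ : γ ≤ n)
    (hCinj : ∀ t < γ, ∀ t' < γ, C t = C t' → t = t') (hDn : ∀ t < γ, D t < n) :
    Run placeTuple s (100 * n + 100) (fun s' =>
      (s'.nReg 4 ≠ 0 → Placed n C D γ (s'.nArr 7) (s'.nArr 6)) ∧
      (s'.nReg 4 = 0 → ¬ ∀ t < γ, ∀ t' < γ, D t = D t' → t = t')) := by
  refine Run.seq (T₂ := 50 * n + 50) (Run.forTo (T := 10) (N := n) (fun i s' =>
    ∀ v < i, s'.nArr 6 v = n ∧ s'.nArr 7 v = 0) hn (by decide) rfl rfl (by simp) ?_ le_rfl) ?_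
    (by omega)
  · intro i hi s₁ F₁ hx hI
    have hn₁ : s₁.nReg 0 = n := (F₁.nReg 0 rfl).trans hn
    refine .straight rfl (by decide) fun v hv => ?_
    by_cases hvi : v = i
    · simp [hx, hvi, hn₁]
    · simpa [hx, hvi] using hI v (by omega)
  rintro s₁ ⟨h₁, F₁⟩
  refine Run.seq (T₁ := 2) (T₂ := 40 * n + 10) (R := fun s' => s' = s₁.setN 4 1)
    (.straight rfl (by decide) rfl) ?_ (by omega)
  rintro _ rfl
  have h3₁ : (s₁.setN 4 1).nReg 3 = γ := by simpa [F₁.nReg 3 rfl] using h3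
  refine Run.mono (Run.forTo (T := 25) (N := γ) (fun i s' =>
    (s'.nReg 4 ≠ 0 → Placed n C D i (s'.nArr 7) (s'.nArr 6)) ∧
      (s'.nReg 4 = 0 → ¬ ∀ t < γ, ∀ t' < γ, D t = D t' → t = t')) h3₁ (by decide) rfl rfl
    ⟨fun _ => ⟨by simp, by simp, ?_, ?_⟩, by simp⟩ ?_ le_rfl) (by omega) fun s' h => h.1
  · intro v hv _
    simpa using (h₁ v hv).1
  · intro q hq
    simpa using (h₁ q hq).2
  · rintro i hi s₂ F₂ hx ⟨hI₁, hI₂⟩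
    have hD₂ : s₂.nArr 2 = D := by rw [F₂.nArr 2 rfl]; simp [F₁.nArr 2 rfl, hD]
    have hC₂ : s₂.nArr 3 = C := by rw [F₂.nArr 3 rfl]; simp [F₁.nArr 3 rfl, hC]
    have hDi := hDn i hi
    refine Run.ite (T := 12) (fun hb => .straight rfl (by decide) ⟨?_, ?_⟩)
      (fun hb => .straight rfl (by decide) ⟨by simp, ?_⟩) (by decide)
    · simp only [BExp.Holds, NExp.eval, hx, hD₂, Nat.le_zero] at hb
      intro h4
      obtain ⟨hinj, hseat, hfree, hmark⟩ := hI₁ (by simpa using h4)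
      have hnew : ∀ t < i, D t ≠ D i := fun t ht he => (hmark (D i) hDi).mpr ⟨t, ht, he⟩ hb
      refine ⟨?_, ?_, ?_, ?_⟩
      · intro t ht t' ht' he
        rcases Nat.lt_succ_iff_lt_or_eq.mp ht with ht | rfl <;>
          rcases Nat.lt_succ_iff_lt_or_eq.mp ht' with ht' | rfl
        · exact hinj t ht t' ht' he
        · exact absurd he (hnew t ht)
        · exact absurd he.symm (hnew t' ht')
        · rfl
      · intro t ht
        rcases Nat.lt_succ_iff_lt_or_eq.mp ht with ht | rfl
        · have : C t ≠ C i := fun he => ht.ne (hCinj t (by omega) i hi he)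
          simpa [hx, hC₂, hD₂, this] using hseat t ht
        · simp [hx, hC₂, hD₂]
      · intro v hv hv'
        have : v ≠ C i := (hv' i (by omega)).symm
        simpa [hx, hC₂, hD₂, this] using hfree v hv fun t ht => hv' t (by omega)
      · intro q hq
        by_cases hqi : q = D i
        · simp only [Prog.run, NExp.eval, State.putN_nArr, State.putN_nReg, State.setN_nArr, hx, hD₂,
            show (7 : ℕ) ≠ 6 by decide, if_false, if_true, hqi, Function.update_self]
          exact ⟨fun _ => ⟨i, by omega, rfl⟩, fun _ => one_ne_zero⟩
        · simp only [Prog.run, NExp.eval, State.putN_nArr, State.putN_nReg, State.setN_nArr, hx, hD₂,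
            show (7 : ℕ) ≠ 6 by decide, if_false, if_true, Function.update_of_ne hqi, hmark q hq]
          constructor
          · rintro ⟨t, ht, he⟩
            exact ⟨t, by omega, he⟩
          · rintro ⟨t, ht, he⟩
            refine ⟨t, ?_, he⟩
            have : t ≠ i := by rintro rfl; exact hqi he.symm
            omega
    · simpa using hI₂
    · simp only [BExp.Holds, NExp.eval, hx, hD₂, Nat.le_zero] at hb
      intro _ hinj
      by_cases h4 : s₂.nReg 4 = 0
      · exact hI₂ h4 hinj
      · obtain ⟨t, ht, he⟩ := ((hI₁ h4).mark (D i) hDi).mp hb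
        exact ht.ne (hinj t (by omega) i hi he)

/-- Every occupied seat belongs to the cover and is marked, so no tightness has to be checked on the
unmarked seats; this is the starting point of the Hungarian method. -/
theorem Placed.partial {γ : ℕ} {C D A M p : ℕ → ℕ} {w : ℕ → ℕ → ℝ} {u y : ℕ → ℝ}
    (h : Placed n C D γ A p) (hCn : ∀ t < γ, C t < n) (hDn : ∀ t < γ, D t < n)
    (hM : ∀ v < n, M v ≠ 0 ↔ ∃ t < γ, C t = v)
    (hfeas : ∀ q < n, ∀ v < n, w q v ≤ u q + y v) : Partial n w A M p 0 p u y := by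
  have hcase : ∀ v < n, p v < n → ∃ t < γ, C t = v := by
    intro v hv hpv
    by_contra! hcon
    exact hpv.ne (h.free v hv hcon)
  refine ⟨fun q hq v hv _ => hfeas q hq v hv, ?_, ?_, ?_, ?_, ?_⟩
  · intro v hv hMv hpv
    exact absurd hMv ((hM v hv).mpr (hcase v hv hpv))
  · intro v hv
    by_cases hc : ∃ t < γ, C t = v
    · obtain ⟨t, ht, rfl⟩ := hc
      rw [h.seated t ht]
      exact (hDn t ht).le
    · push Not at hc
      rw [h.free v hv hc]
  · intro v hv v' hv' hpv he
    obtain ⟨t, ht, rfl⟩ := hcase v hv hpv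
    obtain ⟨t', ht', rfl⟩ := hcase v' hv' (he ▸ hpv)
    rw [h.seated t ht, h.seated t' ht'] at he
    rw [h.inj t ht t' ht' he]
  · intro q hq
    rw [h.mark q hq]
    constructor
    · rintro ⟨v, hv, rfl⟩
      obtain ⟨t, ht, rfl⟩ := hcase v hv hq
      exact .inl ⟨t, ht, (h.seated t ht).symm⟩
    · rintro (⟨t, ht, rfl⟩ | h0)
      · exact ⟨C t, hCn t ht, h.seated t ht⟩
      · exact absurd h0 (Nat.not_lt_zero q)
  · intro v hv hMv
    obtain ⟨t, ht, rfl⟩ := (hM v hv).mp hMv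
    refine ⟨rfl, ?_⟩
    rw [h.seated t ht]
    exact hDn t ht

/-! ### Keeping the best arrangement -/

/-- Unless register 11 is zero, array 1 holds an arrangement, and register 1 for reals holds its
welfare. -/
def Stored (n : ℕ) (adj : ℕ → ℕ → Prop) (g : ℕ → ℕ → ℝ) (s : State) : Prop :=
  s.nReg 11 ≠ 0 → ∃ σ, Permutes n σ ∧ (∀ v < n, s.nArr 1 (σ v) = v) ∧
    s.rReg 1 = welfare n adj g σ

/-- An arrangement of welfare at least `r` is stored. -/
def Achieved (s : State) (r : ℝ) : Prop := s.nReg 11 ≠ 0 ∧ r ≤ s.rReg 1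

/-- Compute the welfare of the arrangement in array 6, and store the arrangement if none with
larger welfare is stored. -/
def evaluate : Prog :=
  .rSet 0 .zero ⨟
  .forTo 5 0 (.forTo 6 0
    (.ite (.nle (.const 1) (.get 0 (.add (.get 5 (.reg 5)) (.reg 6))))
      (.rSet 0 (.add (.reg 0) (.get 0 (.add (.get 5 (.get 6 (.reg 5))) (.get 6 (.reg 6))))))
      .skip)) ⨟
  .ite (.and (.not (.nle (.reg 11) (.const 0))) (.not (.rle (.reg 1) (.reg 0))))
    .skip
    (.rSet 1 (.reg 0) ⨟ .nSet 11 (.const 1) ⨟ .forTo 5 0 (.nPut 1 (.get 6 (.reg 5)) (.reg 5)))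

-- The last two conclusions make the stored welfare a running maximum: the new value is attained,
-- and nothing attained before is lost.
open Classical in
theorem run_evaluate {s : State} {σ : ℕ → ℕ} (hn : 1 ≤ n) (hin : Input n adj g s)
    (h6 : s.nArr 6 = σ) (hσ : Permutes n σ) (hS : Stored n adj g s) :
    Run evaluate s (150 * n ^ 2) (fun s' => Stored n adj g s' ∧
      Achieved s' (welfare n adj g σ) ∧ ∀ r, Achieved s r → Achieved s' r) := by
  have hnn : n ≤ n ^ 2 := Nat.le_self_pow (by norm_num) n
  refine Run.seq (T₁ := 2) (T₂ := 145 * n ^ 2) (R := fun s' => s' = s.setR 0 0)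
    (.straight rfl (by decide) (by simp)) ?_ (by omega)
  rintro _ rfl
  have hin' : Input n adj g (s.setR 0 0) := ⟨hin.size, hin.adj_iff, hin.pref, hin.off⟩
  refine Run.seq (T₁ := 80 * n ^ 2) (T₂ := 60 * n ^ 2) (Run.forTo (T := n * 40 + 8) (N := n)
    (fun j s' => s'.rReg 0 = ∑ v ∈ Finset.range j, ∑ x ∈ Finset.range n,
      if adj v x then g (σ v) (σ x) else 0) hin'.size (by decide) rfl rfl (by simp) ?_ ?_) ?_
      (by omega)
  · intro j hj s₁ F₁ hx hI
    have hin₁ : Input n adj g s₁ := ⟨by rw [F₁.nReg 0 rfl]; exact hin'.size,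
      by rw [F₁.nArr 0 rfl]; exact hin'.adj_iff, by rw [F₁.rArr 0 rfl]; exact hin'.pref,
      by rw [F₁.nArr 5 rfl]; exact hin'.off⟩
    have h6₁ : s₁.nArr 6 = σ := (F₁.nArr 6 rfl).trans h6
    refine Run.mono (Run.forTo (T := 30) (N := n) (fun i s' => s'.rReg 0 =
      (∑ v ∈ Finset.range j, ∑ x ∈ Finset.range n, if adj v x then g (σ v) (σ x) else 0) +
      ∑ x ∈ Finset.range i, if adj j x then g (σ j) (σ x) else 0)
      hin₁.size (by decide) rfl rfl (by simpa using hI) ?_ le_rfl) le_rfl ?_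
    · intro i hi s₂ F₂ hy hJ
      have hin₂ : Input n adj g s₂ := hin₁.of_frame F₂
      have h6₂ : s₂.nArr 6 = σ := (F₂.nArr 6 rfl).trans h6₁
      have hx₂ : s₂.nReg 5 = j := (F₂.nReg 5 rfl).trans hx
      refine Run.ite (T := 15) (fun hb => .straight rfl (by decide) ?_)
        (fun hb => .straight rfl (by decide) ?_) (by decide)
      · simp only [BExp.Holds, NExp.eval, hx₂, hy, hin₂.off j hj, hin₂.adj_iff j hj i hi] at hb
        simp only [Prog.run, RExp.eval, NExp.eval, State.setN_rReg, State.setR_rReg, if_true, hx₂,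
          hy, h6₂, hin₂.off _ (hσ.1 j hj), hin₂.pref _ (hσ.1 j hj) _ (hσ.1 i hi),
          Finset.sum_range_succ, hJ]
        rw [if_pos hb, add_assoc]
      · simp only [BExp.Holds, NExp.eval, hx₂, hy, hin₂.off j hj, hin₂.adj_iff j hj i hi] at hb
        simp only [Prog.run, State.setN_rReg, Finset.sum_range_succ, hJ]
        rw [if_neg hb, add_zero]
    · rintro s₂ ⟨hJ, -⟩
      simp only [State.setN_rReg]
      rw [Finset.sum_range_succ, hJ]
  · have : n * (n * 40 + 8 + 10) = 40 * n ^ 2 + 18 * n := by ring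
    omega
  rintro s₁ ⟨hacc, F₁⟩
  replace hacc : s₁.rReg 0 = welfare n adj g σ := hacc
  have h1 : s₁.rReg 1 = s.rReg 1 := by rw [F₁.rReg 1 rfl]; simp
  have h11 : s₁.nReg 11 = s.nReg 11 := F₁.nReg 11 rfl
  have ha1 : s₁.nArr 1 = s.nArr 1 := F₁.nArr 1 rfl
  have h6₁ : s₁.nArr 6 = σ := (F₁.nArr 6 rfl).trans h6
  have hn₁ : s₁.nReg 0 = n := (F₁.nReg 0 rfl).trans hin.size
  refine Run.ite (T := 20 * n + 20) ?_ ?_ (by simp only [BExp.cost, NExp.cost, RExp.cost]; omega)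
  · intro hb
    simp only [BExp.Holds, NExp.eval, RExp.eval, hacc, h1, h11, Nat.le_zero] at hb
    refine .straight rfl ((by decide : _ ≤ 1).trans (by omega)) ⟨?_, ?_, ?_⟩
    · intro _
      obtain ⟨τ, hτ⟩ := hS hb.1
      exact ⟨τ, by simpa [h1, ha1] using hτ⟩
    · exact ⟨by simpa [h11] using hb.1, by simpa [h1] using (not_le.mp hb.2).le⟩
    · intro r hr
      simpa [Achieved, h1, h11] using hr
  · intro hb
    simp only [BExp.Holds, NExp.eval, RExp.eval, hacc, h1, h11, Nat.le_zero] at hb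
    refine Run.seq (T₁ := 2) (T₂ := 20 * n + 15)
      (R := fun s' => s' = s₁.setR 1 (welfare n adj g σ))
      (.straight rfl (by decide) (by simp [hacc])) ?_ (by omega)
    rintro _ rfl
    refine Run.seq (T₁ := 2) (T₂ := 20 * n + 10)
      (R := fun s' => s' = (s₁.setR 1 (welfare n adj g σ)).setN 11 1)
      (.straight rfl (by decide) (by simp)) ?_ (by omega)
    rintro _ rfl
    refine Run.mono (Run.forTo (T := 5) (N := n) (fun i s' => ∀ v < i, s'.nArr 1 (σ v) = v)
      (by simp [hn₁]) (by decide) rfl rfl (by simp) ?_ le_rfl) (by omega) ?_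
    · intro i hi s₂ F₂ hx hI
      have h6₂ : s₂.nArr 6 = σ := by rw [F₂.nArr 6 rfl]; simp [h6₁]
      refine .straight rfl (by decide) fun v hv => ?_
      by_cases hvi : v = i
      · simp [hx, hvi, h6₂]
      -- Different seats have different agents, so earlier output entries are not overwritten.
      · have : σ v ≠ σ i := fun he => hvi (hσ.2 v (by omega) i hi he)
        simpa [hx, h6₂, this] using hI v (by omega)
    · rintro s₂ ⟨hI, F₂⟩
      have h1₂ : s₂.rReg 1 = welfare n adj g σ := by rw [F₂.rReg 1 rfl]; simp
      have h11₂ : s₂.nReg 11 = 1 := by rw [F₂.nReg 11 rfl]; simp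
      refine ⟨fun _ => ⟨σ, hσ, hI, h1₂⟩, ⟨by simp [h11₂], h1₂.ge⟩, fun r hr => ⟨by simp [h11₂], ?_⟩⟩
      rw [h1₂]
      refine hr.2.trans ?_
      by_contra hcon
      exact hb ⟨hr.1, hcon⟩

/-- Find the best arrangement with the current tuple of agents on the vertex cover. -/
def tryTuple : Prog :=
  placeTuple ⨟ .ite (.nle (.reg 4) (.const 0)) .skip (setWeights ⨟ hungarian ⨟ evaluate)

/-- The state holds the input and a minimum vertex cover `C 0, …, C (γ - 1)`. -/
structure CoverGiven (n : ℕ) (adj : ℕ → ℕ → Prop) (g : ℕ → ℕ → ℝ) (γ : ℕ) (C : ℕ → ℕ)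
    (s : State) : Prop where
  input : Input n adj g s
  num : s.nReg 3 = γ
  cover : s.nArr 3 = C
  le : γ ≤ n
  inj : ∀ t < γ, ∀ t' < γ, C t = C t' → t = t'
  lt : ∀ t < γ, C t < n
  mark : ∀ v < n, s.nArr 4 v ≠ 0 ↔ ∃ t < γ, C t = v
  covers : Covers n adj (s.nArr 4)

theorem CoverGiven.of_frame {γ : ℕ} {C : ℕ → ℕ} {s s' : State} {c : Prog}
    (h : CoverGiven n adj g γ C s) (hF : Frame c s s') (h₀ : c.setsN 0 = false := by rfl)
    (h₁ : c.putsN 0 = false := by rfl) (h₂ : c.putsN 5 = false := by rfl)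
    (h₃ : c.putsR 0 = false := by rfl) (h₄ : c.setsN 3 = false := by rfl)
    (h₅ : c.putsN 3 = false := by rfl) (h₆ : c.putsN 4 = false := by rfl) :
    CoverGiven n adj g γ C s' where
  input := h.input.of_frame hF h₀ h₁ h₂ h₃
  num := (hF.nReg 3 h₄).trans h.num
  cover := (hF.nArr 3 h₅).trans h.cover
  le := h.le
  inj := h.inj
  lt := h.lt
  mark := by rw [hF.nArr 4 h₆]; exact h.mark
  covers := by rw [hF.nArr 4 h₆]; exact h.covers

/-- After this call the stored welfare dominates every arrangement whose agents on the cover form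
the tuple `D`. -/
theorem run_tryTuple {s : State} {γ : ℕ} {C D : ℕ → ℕ} (hn : 1 ≤ n)
    (hsymm : ∀ v x, adj v x → adj x v) (h : CoverGiven n adj g γ C s) (hD : s.nArr 2 = D)
    (hDn : ∀ t < γ, D t < n) (hS : Stored n adj g s) :
    Run tryTuple s (2000 * n ^ 3) (fun s' => Stored n adj g s' ∧
      (∀ r, Achieved s r → Achieved s' r) ∧
      ∀ σ, Permutes n σ → (∀ t < γ, σ (C t) = D t) → Achieved s' (welfare n adj g σ)) := by
  have hn3 : n ≤ n ^ 3 := Nat.le_self_pow (by norm_num) n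
  have hn2 : n ^ 2 ≤ n ^ 3 := Nat.pow_le_pow_right hn (by norm_num)
  refine Run.seq (T₂ := 1700 * n ^ 3)
    (run_placeTuple h.input.size h.num h.cover hD h.le h.inj hDn).frame ?_ (by omega)
  rintro s₁ ⟨⟨hpos, hneg⟩, F₁⟩
  have hS₁ : Stored n adj g s₁ := by
    rwa [Stored, F₁.nReg 11 rfl, F₁.rReg 1 rfl, F₁.nArr 1 rfl]
  have hA₁ : ∀ r, Achieved s r → Achieved s₁ r := fun r hr => by
    rwa [Achieved, F₁.nReg 11 rfl, F₁.rReg 1 rfl]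
  refine Run.ite (T := 1600 * n ^ 3) ?_ ?_ (by simp only [BExp.cost, NExp.cost]; omega)
  · intro hb
    simp only [BExp.Holds, NExp.eval, Nat.le_zero] at hb
    refine .straight rfl ((by decide : _ ≤ 1).trans (by omega)) ⟨hS₁, hA₁, ?_⟩
    intro σ hσ hσC
    -- A rejected tuple has a repetition, whereas an arrangement puts distinct agents on the
    -- distinct seats of the cover; no arrangement is missed.
    refine absurd (fun t ht t' ht' he => h.inj t ht t' ht' ?_) (hneg hb)
    rw [← hσC t ht, ← hσC t' ht'] at he
    exact hσ.2 _ (h.lt t ht) _ (h.lt t' ht') he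
  · intro hb
    simp only [BExp.Holds, NExp.eval, Nat.le_zero] at hb
    have hpl := hpos hb
    have h₁ := h.of_frame F₁
    refine Run.seq (T₂ := 1300 * n ^ 3) (run_setWeights hn h₁.input rfl rfl ?_).frame ?_ (by omega)
    · intro x hx hMx
      obtain ⟨t, ht, rfl⟩ := (h₁.mark x hx).mp hMx
      rw [hpl.seated t ht]
      exact hDn t ht
    rintro s₂ ⟨⟨hw, hy⟩, F₂⟩
    have h₂ := h₁.of_frame F₂
    have hW : Weighted n (seatWeight n adj g (s₁.nArr 4) (s₁.nArr 6)) (s₁.nArr 7) (s₁.nArr 4) s₂ :=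
      ⟨h₂.input.size, h₂.input.off, fun q hq v hv => (hw q hq v hv).1, F₂.nArr 7 rfl,
        F₂.nArr 4 rfl⟩
    have hP : Partial n (seatWeight n adj g (s₁.nArr 4) (s₁.nArr 6)) (s₁.nArr 7) (s₁.nArr 4)
        (s₁.nArr 6) 0 (s₂.nArr 6) (s₂.rArr 2) (s₂.rArr 3) := by
      rw [F₂.nArr 6 rfl]
      refine hpl.partial h.lt hDn h₁.mark fun q hq v hv => ?_
      rw [hy v hv, add_zero]
      exact (hw q hq v hv).2
    refine Run.seq (T₂ := 200 * n ^ 3) (run_hungarian hn hW hP).frame ?_ (by omega)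
    rintro s₃ ⟨hP₃, F₃⟩
    have h₃ := h₂.of_frame F₃
    have e11 : s₃.nReg 11 = s₁.nReg 11 := by rw [F₃.nReg 11 rfl, F₂.nReg 11 rfl]
    have e1 : s₃.rReg 1 = s₁.rReg 1 := by rw [F₃.rReg 1 rfl, F₂.rReg 1 rfl]
    have ea : s₃.nArr 1 = s₁.nArr 1 := by rw [F₃.nArr 1 rfl, F₂.nArr 1 rfl]
    refine Run.mono (run_evaluate hn h₃.input rfl hP₃.permutes (by rwa [Stored, e11, e1, ea]))
      (by omega) ?_
    rintro s₄ ⟨hS₄, hbest, hmono⟩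
    refine ⟨hS₄, fun r hr => hmono r ?_, fun σ hσ hσC => ⟨hbest.1, le_trans ?_ hbest.2⟩⟩
    · rw [Achieved, e11, e1]
      exact hA₁ r hr
    · refine hP₃.welfare_le hsymm h₁.covers hσ fun v hv hMv => ?_
      obtain ⟨t, ht, rfl⟩ := (h₁.mark v hv).mp hMv
      rw [hσC t ht, hpl.seated t ht]

/-! ### The whole algorithm -/

/-- Try all tuples of agents for the vertex cover. -/
def tryAll : Prog := .while (.nle (.reg 1) (.reg 3)) (tryTuple ⨟ nextTuple)

/-- Invariant: every arrangement whose tuple on the cover precedes the current one in the counting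
order has been dominated. When the counter overflows to length `γ + 1` the loop ends, and all
arrangements have been covered because base `n` values of `γ` digits lie below `n ^ γ`. -/
theorem run_tryAll {s : State} {γ : ℕ} {C : ℕ → ℕ} (hn : 1 ≤ n)
    (hsymm : ∀ v x, adj v x → adj x v) (h : CoverGiven n adj g γ C s) (h1 : s.nReg 1 = γ)
    (hD : ∀ t < γ, s.nArr 2 t = 0) (hS : Stored n adj g s) :
    Run tryAll s (2200 * (n ^ γ * n ^ 3)) (fun s' => Stored n adj g s' ∧
      ∀ σ, Permutes n σ → Achieved s' (welfare n adj g σ)) := by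
  have hn3 : n ≤ n ^ 3 := Nat.le_self_pow (by norm_num) n
  refine Run.mono (Run.while (K := n ^ γ) (T := 2100 * n ^ 3) (fun m s' => Stored n adj g s' ∧
    ((s'.nReg 1 = γ ∧ (∀ t < γ, s'.nArr 2 t < n) ∧ digitsValue n γ (s'.nArr 2) + m = n ^ γ ∧
      ∀ σ, Permutes n σ → digitsValue n γ (fun t => σ (C t)) < digitsValue n γ (s'.nArr 2) →
        Achieved s' (welfare n adj g σ)) ∨
      (s'.nReg 1 = γ + 1 ∧ ∀ σ, Permutes n σ → Achieved s' (welfare n adj g σ))))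
    ⟨hS, .inl ⟨h1, fun t ht => by rw [hD t ht]; omega, by rw [digitsValue_zero hD, zero_add], ?_⟩⟩
    ?_ le_rfl) ?_ ?_
  · intro σ _ hlt
    rw [digitsValue_zero hD] at hlt
    exact absurd hlt (Nat.not_lt_zero _)
  · rintro m s₁ F₁ ⟨hS₁, hI⟩ hb
    have h₁ : CoverGiven n adj g γ C s₁ := h.of_frame F₁
    simp only [BExp.Holds, NExp.eval, h₁.num] at hb
    rcases hI with ⟨hk, hDn, hval, hbest⟩ | ⟨hk, -⟩
    · refine Run.seq (T₂ := 80 * n ^ 3) (run_tryTuple hn hsymm h₁ rfl hDn hS₁).frame ?_ (by omega)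
      rintro s₂ ⟨⟨hS₂, hmono, hnew⟩, F₂⟩
      have h₂ := h₁.of_frame F₂
      have hD₂ : s₂.nArr 2 = s₁.nArr 2 := F₂.nArr 2 rfl
      have hγ := h.le
      refine Run.mono (run_nextTuple (k := γ) h₂.input.size ((F₂.nReg 1 rfl).trans hk)
        (by rwa [hD₂])).frame (by omega) ?_
      rintro s₃ ⟨hor, F₃⟩
      have hA : ∀ r, Achieved s₂ r → Achieved s₃ r := fun r hr => by
        rwa [Achieved, F₃.nReg 11 rfl, F₃.rReg 1 rfl]
      have hS₃ : Stored n adj g s₃ := by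
        rwa [Stored, F₃.nReg 11 rfl, F₃.rReg 1 rfl, F₃.nArr 1 rfl]
      have hcur : ∀ σ, Permutes n σ →
          digitsValue n γ (fun t => σ (C t)) < digitsValue n γ (s₁.nArr 2) + 1 →
          Achieved s₃ (welfare n adj g σ) := by
        intro σ hσ hlt
        refine hA _ ?_
        rcases Nat.lt_succ_iff_lt_or_eq.mp hlt with hlt | heq
        · exact hmono _ (hbest σ hσ hlt)
        · exact hnew σ hσ (digitsValue_inj (fun t ht => hσ.1 _ (h.lt t ht)) hDn heq)
      have hpos := digitsValue_lt hDn
      refine ⟨m - 1, by omega, hS₃, ?_⟩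
      rw [hD₂] at hor
      rcases hor with ⟨hk', hDn', hval'⟩ | ⟨hk', -, hval'⟩
      · exact .inl ⟨hk', hDn', by omega, by rw [hval']; exact hcur⟩
      · refine .inr ⟨hk', fun σ hσ => hcur σ hσ ?_⟩
        rw [hval']
        exact digitsValue_lt fun t ht => hσ.1 _ (h.lt t ht)
    · omega
  · simp only [BExp.cost, NExp.cost]
    have h1 : 1 ≤ n ^ γ := Nat.one_le_pow _ _ hn
    have h2 : n ^ γ * (2100 * n ^ 3 + (1 + 1 + 1) + 1) = 2100 * (n ^ γ * n ^ 3) + 4 * n ^ γ := by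
      ring
    have h3 : n ^ γ * 1 ≤ n ^ γ * n ^ 3 := Nat.mul_le_mul_left _ (hn.trans hn3)
    omega
  · rintro s' ⟨⟨m, hS', hI⟩, hb, F⟩
    have h' : CoverGiven n adj g γ C s' := h.of_frame F
    simp only [BExp.Holds, NExp.eval, h'.num] at hb
    rcases hI with ⟨hk, -⟩ | ⟨-, hI⟩
    · omega
    · exact ⟨hS', hI⟩

/-- Search for a tuple of minimum length that is a vertex cover. -/
def findCover : Prog :=
  .while (.nle (.reg 4) (.const 0))
    (checkCover ⨟ .ite (.nle (.reg 4) (.const 0)) nextTuple .skip)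

/-- The entries `D 0, …, D (k - 1)` form a vertex cover. -/
def IsCoverTuple (n : ℕ) (adj : ℕ → ℕ → Prop) (k : ℕ) (D : ℕ → ℕ) : Prop :=
  ∀ v < n, ∀ x < n, adj v x → (∃ t < k, D t = v) ∨ ∃ t < k, D t = x

theorem covers_iff {M D : ℕ → ℕ} {k : ℕ} (hM : ∀ v < n, M v ≠ 0 ↔ ∃ t < k, D t = v) :
    Covers n adj M ↔ IsCoverTuple n adj k D :=
  forall₂_congr fun v hv => forall₂_congr fun x hx => by rw [hM v hv, hM x hx]

/-- Tuples are ranked by length and then by value. The search cannot pass the known cover `X`, so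
the distance to its rank bounds the remaining rounds. Only a length of at most `γ` is claimed here;
minimality enters later. -/
theorem run_findCover {s : State} {γ : ℕ} {X : ℕ → ℕ} (hn : 1 ≤ n) (hin : Input n adj g s)
    (hγ : γ ≤ n) (hXn : ∀ t < γ, X t < n) (hX : IsCoverTuple n adj γ X)
    (h1 : s.nReg 1 = 0) (h4 : s.nReg 4 = 0) :
    Run findCover s (500 * ((γ + 1) * n ^ γ * n ^ 2)) (fun s' => ∃ k ≤ γ, s'.nReg 1 = k ∧
      (∀ t < k, s'.nArr 2 t < n) ∧ (∀ v < n, s'.nArr 4 v ≠ 0 ↔ ∃ t < k, s'.nArr 2 t = v) ∧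
      Covers n adj (s'.nArr 4)) := by
  have hn2 : n ≤ n ^ 2 := Nat.le_self_pow (by norm_num) n
  set rank : ℕ → ℕ → ℕ := fun k c => ∑ t ∈ Finset.range k, n ^ t + c with hrank
  set c₀ := digitsValue n γ X with hc₀
  have hc₀n : c₀ < n ^ γ := digitsValue_lt hXn
  have hmono : ∀ k < γ, ∀ c < n ^ k, rank k c < rank γ c₀ := by
    intro k hk c hc
    have : ∑ t ∈ Finset.range (k + 1), n ^ t ≤ ∑ t ∈ Finset.range γ, n ^ t :=
      Finset.sum_le_sum_of_subset (Finset.range_mono hk)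
    rw [Finset.sum_range_succ] at this
    simp only [hrank]
    omega
  refine Run.mono (Run.while (K := rank γ c₀ + 1) (T := 350 * n ^ 2) (fun m s' => ∃ k ≤ γ,
    s'.nReg 1 = k ∧ (∀ t < k, s'.nArr 2 t < n) ∧
    (s'.nReg 4 = 0 → (k < γ ∨ digitsValue n k (s'.nArr 2) ≤ c₀) ∧
      rank k (digitsValue n k (s'.nArr 2)) + m = rank γ c₀ + 1) ∧
    (s'.nReg 4 ≠ 0 → (∀ v < n, s'.nArr 4 v ≠ 0 ↔ ∃ t < k, s'.nArr 2 t = v) ∧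
      Covers n adj (s'.nArr 4)))
    ⟨0, Nat.zero_le _, h1, by simp, ?_, fun h => absurd h4 h⟩ ?_ le_rfl) ?_ ?_
  · intro _
    refine ⟨?_, by simp [hrank, digitsValue]⟩
    right
    simp [digitsValue]
  · rintro m s₁ F₁ ⟨k, hkγ, hk, hDn, hI, -⟩ hb
    have hin₁ : Input n adj g s₁ := hin.of_frame F₁
    simp only [BExp.Holds, NExp.eval, Nat.le_zero] at hb
    obtain ⟨hor, hm⟩ := hI hb
    have hpos := digitsValue_lt hDn
    have hle : rank k (digitsValue n k (s₁.nArr 2)) ≤ rank γ c₀ := by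
      rcases hkγ.lt_or_eq with hlt | rfl
      · exact (hmono k hlt _ hpos).le
      · rcases hor with h | h
        · exact absurd h (lt_irrefl _)
        · simpa [hrank] using h
    refine Run.seq (T₂ := 140 * n ^ 2) (run_checkCover hin₁ hk (hkγ.trans hγ) hn).frame ?_
      (by omega)
    rintro s₂ ⟨⟨hM, hcov⟩, F₂⟩
    have hD₂ : s₂.nArr 2 = s₁.nArr 2 := F₂.nArr 2 rfl
    have hk₂ : s₂.nReg 1 = k := (F₂.nReg 1 rfl).trans hk
    have hin₂ := hin₁.of_frame F₂
    rw [covers_iff hM] at hcov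
    refine Run.ite (T := 100 * n ^ 2) ?_ ?_ (by simp only [BExp.cost, NExp.cost]; omega)
    · intro hb'
      simp only [BExp.Holds, NExp.eval, Nat.le_zero] at hb'
      have hnot : ¬ IsCoverTuple n adj k (s₁.nArr 2) := fun h => hcov.mpr h hb'
      have hlt : k < γ ∨ digitsValue n k (s₁.nArr 2) < c₀ := by
        rcases hkγ.lt_or_eq with hlt | rfl
        · exact .inl hlt
        · refine .inr ((hor.resolve_left (lt_irrefl _)).lt_of_ne fun he => hnot ?_)
          have heq := digitsValue_inj hDn hXn he
          intro v hv x hx hvx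
          refine (hX v hv x hx hvx).imp ?_ ?_ <;>
          · rintro ⟨t, ht, hte⟩
            exact ⟨t, ht, (heq t ht).trans hte⟩
      refine Run.mono (run_nextTuple (k := k) hin₂.size hk₂ (by rwa [hD₂])).frame (by omega) ?_
      rintro s₃ ⟨hnext, F₃⟩
      have h4₃ : s₃.nReg 4 = 0 := (F₃.nReg 4 rfl).trans hb'
      rw [hD₂] at hnext
      refine ⟨m - 1, by omega, ?_⟩
      rcases hnext with ⟨hk', hDn', hval⟩ | ⟨hk', hz, hval⟩
      · refine ⟨k, hkγ, hk', hDn', fun _ => ⟨?_, ?_⟩, fun h => absurd h4₃ h⟩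
        · rw [hval]; exact hlt
        · rw [hval]
          simp only [hrank] at hm hle ⊢
          omega
      -- No overflow happens at length `γ`: the current value is then below `c₀`, which is itself
      -- below `n ^ γ`.
      · have hkγ' : k < γ := by
          rcases hkγ.lt_or_eq with h | rfl
          · exact h
          · omega
        refine ⟨k + 1, hkγ', hk', fun t ht => by rw [hz t ht]; omega, fun _ => ⟨?_, ?_⟩,
          fun h => absurd h4₃ h⟩
        · rw [digitsValue_zero hz]; exact .inr (Nat.zero_le _)
        · rw [digitsValue_zero hz]
          simp only [hrank, Finset.sum_range_succ] at hm hle ⊢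
          omega
    · intro hb'
      simp only [BExp.Holds, NExp.eval, Nat.le_zero] at hb'
      refine .straight rfl ((by decide : _ ≤ 1).trans (by omega))
        ⟨m - 1, by omega, k, hkγ, hk₂, ?_, fun h => absurd h hb', fun _ => ⟨?_, ?_⟩⟩
      · simpa [hD₂] using hDn
      · simpa [hD₂] using hM
      · simpa [covers_iff hM] using hcov.mp hb'
  -- The rank plus 1 is at most the sum of `n ^ t` over `t ≤ γ`, each term of which is at most `n ^
  -- γ`.
  · have h5 : rank γ c₀ + 1 ≤ (γ + 1) * n ^ γ := by
      have h6 : ∑ t ∈ Finset.range (γ + 1), n ^ t ≤ ∑ _t ∈ Finset.range (γ + 1), n ^ γ :=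
        Finset.sum_le_sum fun t ht => Nat.pow_le_pow_right hn (by
          have := Finset.mem_range.mp ht
          omega)
      rw [Finset.sum_const, Finset.card_range, smul_eq_mul, Finset.sum_range_succ] at h6
      simp only [hrank]
      omega
    simp only [BExp.cost, NExp.cost]
    have h7 : (rank γ c₀ + 1) * (350 * n ^ 2 + (1 + 1 + 1) + 1) ≤
        (γ + 1) * n ^ γ * (354 * n ^ 2) := Nat.mul_le_mul h5 (by omega)
    have h8 : (γ + 1) * n ^ γ * (354 * n ^ 2) = 354 * ((γ + 1) * n ^ γ * n ^ 2) := by ring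
    have h9 : 1 ≤ (γ + 1) * n ^ γ * n ^ 2 :=
      Nat.one_le_iff_ne_zero.mpr (by positivity)
    omega
  · rintro s' ⟨⟨m, k, hkγ, hk, hDn, -, hI⟩, hb, -⟩
    simp only [BExp.Holds, NExp.eval, Nat.le_zero] at hb
    exact ⟨k, hkγ, hk, hDn, hI hb⟩

/-- Compute the offsets of the rows of `n × n` matrices. -/
def setOffsets : Prog :=
  .forTo 5 0 (.nPut 5 (.reg 5) (.reg 2) ⨟ .nSet 2 (.add (.reg 2) (.reg 0)))

/-- The machine cannot multiply, so the offsets come from repeated addition in register 2. -/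
theorem run_setOffsets {s : State} (hn : s.nReg 0 = n) (h2 : s.nReg 2 = 0) :
    Run setOffsets s (20 * n + 10) (fun s' => ∀ v < n, s'.nArr 5 v = v * n) := by
  refine Run.mono (Run.forTo (T := 8) (N := n) (fun i s' =>
    s'.nReg 2 = i * n ∧ ∀ v < i, s'.nArr 5 v = v * n) hn (by decide) rfl rfl (by simp [h2]) ?_
    le_rfl) (by omega) fun s' h => h.1.2
  rintro i hi s₁ F₁ hx ⟨hI₁, hI₂⟩
  have hn₁ : s₁.nReg 0 = n := (F₁.nReg 0 rfl).trans hn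
  refine .straight rfl (by decide) ⟨by simp [hI₁, hn₁, Nat.succ_mul], fun v hv => ?_⟩
  by_cases hvi : v = i
  · simp [hx, hvi, hI₁]
  · simpa [hx, hvi] using hI₂ v (by omega)

/-- Save the vertex cover, and start with the first tuple of the same length. -/
def saveCover : Prog :=
  .nSet 3 (.reg 1) ⨟ .forTo 5 1 (.nPut 3 (.reg 5) (.get 2 (.reg 5)) ⨟ .nPut 2 (.reg 5) (.const 0))

theorem run_saveCover {s : State} {k : ℕ} (h1 : s.nReg 1 = k) :
    Run saveCover s (20 * k + 15) (fun s' => s'.nReg 3 = k ∧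
      ∀ t < k, s'.nArr 3 t = s.nArr 2 t ∧ s'.nArr 2 t = 0) := by
  refine Run.seq (T₁ := 2) (T₂ := 20 * k + 10) (R := fun s' => s' = s.setN 3 k)
    (.straight rfl (by decide) (by simp [h1])) ?_ (by omega)
  rintro _ rfl
  refine Run.mono (Run.forTo (T := 8) (N := k) (fun i s' =>
    (∀ t < i, s'.nArr 3 t = s.nArr 2 t ∧ s'.nArr 2 t = 0) ∧ ∀ t ≥ i, s'.nArr 2 t = s.nArr 2 t)
    (by simp [h1]) (by decide) rfl rfl (by simp) ?_ le_rfl) (by omega) ?_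
  · rintro i hi s₁ F₁ hx ⟨hI₁, hI₂⟩
    refine .straight rfl (by decide) ⟨fun t ht => ?_, fun t ht => ?_⟩
    · by_cases hti : t = i
      · simp [hx, hti, hI₂]
      · simpa [hx, hti] using hI₁ t (by omega)
    · have hti : t ≠ i := by omega
      simpa [hx, hti] using hI₂ t (by omega)
  · rintro s₁ ⟨⟨hI, -⟩, F₁⟩
    exact ⟨by rw [F₁.nReg 3 rfl]; simp, hI⟩

/-- Maximum Welfare Arrangement: find a minimum vertex cover, and for each choice of the agents on
the vertex cover solve an assignment problem for the other agents. -/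
def maximumWelfare : Prog := setOffsets ⨟ findCover ⨟ saveCover ⨟ tryAll

theorem run_maximumWelfare {s : State} {γ : ℕ} {X : ℕ → ℕ} (hn : 1 ≤ n)
    (hsize : s.nReg 0 = n) (hzero : ∀ x ≠ 0, s.nReg x = 0)
    (hadj : ∀ v < n, ∀ x < n, 1 ≤ s.nArr 0 (v * n + x) ↔ adj v x)
    (hpref : ∀ q < n, ∀ r < n, s.rArr 0 (q * n + r) = g q r)
    (hsymm : ∀ v x, adj v x → adj x v)
    (hγ : γ ≤ n) (hXn : ∀ t < γ, X t < n) (hX : IsCoverTuple n adj γ X)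
    (hmin : ∀ k D, IsCoverTuple n adj k D →
      γ ≤ ((Finset.range k).image D).card) :
    Run maximumWelfare s (3000 * (n ^ γ * ((γ + 1) * n ^ 2 + n ^ 3))) (fun s' => ∃ σ,
      Permutes n σ ∧ (∀ v < n, s'.nArr 1 (σ v) = v) ∧
      ∀ τ, Permutes n τ → welfare n adj g τ ≤ welfare n adj g σ) := by
  have hpow : 1 ≤ n ^ γ := Nat.one_le_pow _ _ hn
  have hn3 : n ≤ n ^ 3 := Nat.le_self_pow (by norm_num) n
  have hle : n ^ 3 ≤ n ^ γ * n ^ 3 := Nat.le_mul_of_pos_left _ hpow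
  have hT : 3000 * (n ^ γ * ((γ + 1) * n ^ 2 + n ^ 3)) =
      3000 * ((γ + 1) * n ^ γ * n ^ 2) + 3000 * (n ^ γ * n ^ 3) := by ring
  refine Run.seq (T₂ := 500 * ((γ + 1) * n ^ γ * n ^ 2) + 2500 * (n ^ γ * n ^ 3))
    (run_setOffsets hsize (hzero 2 (by norm_num))).frame ?_ (by omega)
  rintro s₁ ⟨hoff, F₁⟩
  have hin₁ : Input n adj g s₁ := ⟨(F₁.nReg 0 rfl).trans hsize,
    by rw [F₁.nArr 0 rfl]; exact hadj, by rw [F₁.rArr 0 rfl]; exact hpref, hoff⟩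
  refine Run.seq (T₂ := 2400 * (n ^ γ * n ^ 3)) (run_findCover hn hin₁ hγ hXn hX
    ((F₁.nReg 1 rfl).trans (hzero 1 (by norm_num)))
    ((F₁.nReg 4 rfl).trans (hzero 4 (by norm_num)))).frame ?_ (by omega)
  rintro s₂ ⟨⟨k, hkγ, hk, hDn, hM, hcov⟩, F₂⟩
  have hin₂ := hin₁.of_frame F₂
  have hcard := hmin k _ ((covers_iff hM).mp hcov)
  have hcard' : ((Finset.range k).image (s₂.nArr 2)).card ≤ k :=
    Finset.card_image_le.trans (Finset.card_range k).le
  -- The entries of the tuple found form a cover, so they comprise at least `γ` vertices, while `k ≤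
  -- γ`. Hence the length is exactly `γ` and no entry repeats.
  obtain rfl : k = γ := by omega
  have hinj : ∀ t < k, ∀ t' < k, s₂.nArr 2 t = s₂.nArr 2 t' → t = t' := by
    have : ((Finset.range k).image (s₂.nArr 2)).card = (Finset.range k).card := by
      rw [Finset.card_range]; omega
    intro t ht t' ht' he
    exact Finset.card_image_iff.mp this (by simpa using ht) (by simpa using ht') he
  refine Run.seq (T₂ := 2300 * (n ^ k * n ^ 3)) (run_saveCover hk).frame ?_ (by omega)
  rintro s₃ ⟨⟨h3, hsave⟩, F₃⟩
  have h11 : s₃.nReg 11 = 0 := by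
    rw [F₃.nReg 11 rfl, F₂.nReg 11 rfl, F₁.nReg 11 rfl]
    exact hzero 11 (by norm_num)
  have hC : CoverGiven n adj g k (s₃.nArr 3) s₃ := by
    refine ⟨hin₂.of_frame F₃, h3, rfl, hγ, ?_, ?_, ?_, by rw [F₃.nArr 4 rfl]; exact hcov⟩
    · intro t ht t' ht' he
      rw [(hsave t ht).1, (hsave t' ht').1] at he
      exact hinj t ht t' ht' he
    · intro t ht
      rw [(hsave t ht).1]
      exact hDn t ht
    · intro v hv
      rw [F₃.nArr 4 rfl, hM v hv]
      exact exists_congr fun t => and_congr_right fun ht => by rw [(hsave t ht).1]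
  refine Run.mono (run_tryAll hn hsymm hC ((F₃.nReg 1 rfl).trans hk) (fun t ht => (hsave t ht).2)
    fun h => absurd h11 h) (by omega) ?_
  rintro s₄ ⟨hS, hA⟩
  -- Some arrangement exists, so the search has stored one and `Stored` is not vacuous.
  have hid : Permutes n id := ⟨fun _ h => h, fun _ _ _ _ h => h⟩
  obtain ⟨σ, hσ, hout, hval⟩ := hS (hA id hid).1
  exact ⟨σ, hσ, hout, fun τ hτ => hval ▸ (hA τ hτ).2⟩

end

/-! ### Seat graphs on `Fin n` -/

section

variable {n : ℕ}

/-- Adjacency in `G` of vertices given by their numbers. -/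
def natAdj (G : SimpleGraph (Fin n)) (v x : ℕ) : Prop :=
  ∃ (hv : v < n) (hx : x < n), G.Adj ⟨v, hv⟩ ⟨x, hx⟩

/-- The preferences of agents given by their numbers. -/
noncomputable def natPref (f : Fin n → Fin n → ℝ) (q r : ℕ) : ℝ :=
  if h : q < n ∧ r < n then f ⟨q, h.1⟩ ⟨r, h.2⟩ else 0

theorem rowMajor_apply {α : Type*} [Zero α] (M : Fin n → Fin n → α) {q v : ℕ} (hq : q < n)
    (hv : v < n) : rowMajor M (q * n + v) = M ⟨q, hq⟩ ⟨v, hv⟩ := by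
  have hlt : q * n + v < n * n := by
    have := Nat.mul_le_mul_right n (show q + 1 ≤ n from hq)
    rw [Nat.succ_mul] at this
    omega
  have hdiv : (q * n + v) / n = q := by
    rw [mul_comm, Nat.mul_add_div (by omega), Nat.div_eq_of_lt hv, add_zero]
  have hmod : (q * n + v) % n = v := by
    rw [mul_comm, Nat.mul_add_mod, Nat.mod_eq_of_lt hv]
  simp only [rowMajor, hlt, dif_pos, hdiv, hmod]

-- Reindexing the sum over agents by their seats turns the social welfare into a sum over ordered
-- adjacent pairs of seats.
open Classical in
theorem socialWelfare_eq_welfare (G : SimpleGraph (Fin n)) (f : Fin n → Fin n → ℝ)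
    (π : Arrangement (Fin n) (Fin n)) {σ : ℕ → ℕ} (hσ : ∀ v : Fin n, σ v = π.symm v) :
    socialWelfare G f π = welfare n (natAdj G) (natPref f) σ := by
  rw [socialWelfare, ← Equiv.sum_comp π.symm, welfare, Finset.sum_range]
  refine Finset.sum_congr rfl fun v _ => ?_
  rw [utility, Finset.sum_filter, Finset.sum_range]
  refine Finset.sum_congr rfl fun x _ => ?_
  simp [natAdj, natPref, hσ]

/-- The arrangement in which the agent `σ v` sits at `v`. -/
noncomputable def arrangementOfPermutes {σ : ℕ → ℕ} (hσ : Permutes n σ) :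
    Arrangement (Fin n) (Fin n) :=
  (Equiv.ofBijective (fun v : Fin n => (⟨σ v, hσ.1 v v.2⟩ : Fin n))
    (Finite.injective_iff_bijective.mp fun v v' h =>
      Fin.ext (hσ.2 v v.2 v' v'.2 (Fin.mk.inj_iff.mp h)))).symm

theorem arrangementOfPermutes_symm {σ : ℕ → ℕ} (hσ : Permutes n σ) (v : Fin n) :
    ((arrangementOfPermutes hσ).symm v : ℕ) = σ v := rfl

theorem permutes_of_arrangement (π : Arrangement (Fin n) (Fin n)) :
    Permutes n (fun v => if h : v < n then (π.symm ⟨v, h⟩ : ℕ) else v) := by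
  refine ⟨fun v hv => by simp [hv], fun v hv v' hv' h => ?_⟩
  simpa [hv, hv', ← Fin.ext_iff] using h

theorem exists_isCoverTuple (G : SimpleGraph (Fin n)) {γ : ℕ} (h : G.vertexCoverNum = (γ : ℕ∞)) :
    ∃ X : ℕ → ℕ, (∀ t < γ, X t < n) ∧ IsCoverTuple n (natAdj G) γ X := by
  classical
  obtain ⟨S, hS, hcov⟩ := G.vertexCoverNum_exists
  rw [h, ← Set.coe_toFinset S, Set.encard_coe_eq_coe_finsetCard, Nat.cast_inj] at hS
  let e := S.toFinset.equivFinOfCardEq hS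
  refine ⟨fun t => if ht : t < γ then ((e.symm ⟨t, ht⟩ : Fin n) : ℕ) else 0,
    fun t ht => by simp [ht], ?_⟩
  have hmem : ∀ v : Fin n, v ∈ S → ∃ t < γ,
      (if ht : t < γ then ((e.symm ⟨t, ht⟩ : Fin n) : ℕ) else 0) = v := by
    intro v hv
    refine ⟨e ⟨v, by simpa using hv⟩, (e _).2, ?_⟩
    simp
  rintro v hv x hx ⟨hv', hx', hadj⟩
  exact (hcov hadj).imp (hmem ⟨v, hv⟩) (hmem ⟨x, hx⟩)

theorem vertexCoverNum_le_card_image (G : SimpleGraph (Fin n)) {γ : ℕ}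
    (h : G.vertexCoverNum = (γ : ℕ∞)) (k : ℕ) (D : ℕ → ℕ)
    (hcov : IsCoverTuple n (natAdj G) k D) : γ ≤ ((Finset.range k).image D).card := by
  have hvc : G.IsVertexCover {v | (v : ℕ) ∈ (Finset.range k).image D} := by
    intro v x hadj
    simpa using hcov v v.2 x x.2 ⟨v.2, x.2, hadj⟩
  have h1 := hvc.vertexCoverNum_le
  rw [h] at h1
  have h2 : Set.encard {v : Fin n | (v : ℕ) ∈ (Finset.range k).image D} ≤
      Set.encard (((Finset.range k).image D : Finset ℕ) : Set ℕ) :=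
    Set.encard_le_encard_of_injOn (f := fun v : Fin n => (v : ℕ)) (fun v hv => by simpa using hv)
      fun v _ v' _ he => Fin.ext he
  rw [Set.encard_coe_eq_coe_finsetCard] at h2
  exact_mod_cast h1.trans h2

/-! ### Arithmetic of the time bound -/

/-- The quotient of the cube by the factorial is largest at `γ = 2`, where it is 27/2; this explains
the 14. From 3 on, the induction step only needs `(k + 2) ^ 3 ≤ (k + 1) ^ 4`. -/
theorem succ_pow_three_le_factorial (γ : ℕ) : (γ + 1) ^ 3 ≤ 14 * γ.factorial := by
  induction γ with
  | zero => decide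
  | succ k ih =>
    rcases Nat.lt_or_ge k 3 with hk | hk
    · interval_cases k <;> decide
    · rw [Nat.factorial_succ]
      have : (k + 1 + 1) ^ 3 ≤ (k + 1) * (k + 1) ^ 3 := by
        obtain ⟨m, rfl⟩ := Nat.exists_eq_add_of_le hk
        ring_nf
        nlinarith [Nat.zero_le (m ^ 2), Nat.zero_le (m ^ 3), Nat.zero_le (m ^ 4)]
      calc _ ≤ (k + 1) * (k + 1) ^ 3 := this
        _ ≤ (k + 1) * (14 * k.factorial) := Nat.mul_le_mul_left _ ih
        _ = _ := by ring

/-- Writing n = γ + m + 1 gives n ≤ (γ+1)(m+1), where m + 1 = n - γ. As γ + 1 ≤ n, the search for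
the cover costs no more than the n³ term, which doubles the constant 14. -/
theorem time_bound {γ : ℕ} (h : γ < n) :
    n ^ γ * ((γ + 1) * n ^ 2 + n ^ 3) ≤ 28 * (n ^ γ * γ.factorial * (n - γ) ^ 3) := by
  obtain ⟨m, rfl⟩ := Nat.exists_eq_add_of_lt h
  have hsub : γ + m + 1 - γ = m + 1 := by omega
  rw [hsub]
  set N := γ + m + 1
  have h1 : N ≤ (γ + 1) * (m + 1) := by
    simp only [N]
    nlinarith [Nat.zero_le (γ * m)]
  have h2 : N ^ 3 ≤ (γ + 1) ^ 3 * (m + 1) ^ 3 := by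
    rw [← mul_pow]
    exact Nat.pow_le_pow_left h1 3
  have h3 : (γ + 1) * N ^ 2 ≤ N ^ 3 := by
    rw [pow_succ' N 2]
    exact Nat.mul_le_mul_right _ (by omega)
  have h4 : (γ + 1) ^ 3 * (m + 1) ^ 3 ≤ 14 * γ.factorial * (m + 1) ^ 3 :=
    Nat.mul_le_mul_right _ (succ_pow_three_le_factorial γ)
  calc N ^ γ * ((γ + 1) * N ^ 2 + N ^ 3) ≤ N ^ γ * (2 * (14 * γ.factorial * (m + 1) ^ 3)) :=
        Nat.mul_le_mul_left _ (by omega)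
    _ = _ := by ring

end

end SeatArrangement

/-- There are one program and one constant `C` such that on every instance with `n ≥ 1` agents, and
with vertex cover number `γ` of the seat graph, the program halts after at most
`C * n ^ γ * γ! * (n - γ) ^ 3` steps with a maximum arrangement as output. -/
theorem mainTheorem1 :
    ∃ (P : SeatArrangement.Prog) (C : ℕ),
      ∀ (n : ℕ), 1 ≤ n →
        ∀ (G : SimpleGraph (Fin n)) (f : Fin n → Fin n → ℝ) (γ : ℕ),
          G.vertexCoverNum = (γ : ℕ∞) →
            ∃ (t : ℕ) (s : SeatArrangement.State)
              (π : SeatArrangement.Arrangement (Fin n) (Fin n)),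
              SeatArrangement.Exec P (SeatArrangement.inputState G f) t s ∧
              t ≤ C * (n ^ γ * Nat.factorial γ * (n - γ) ^ 3) ∧
              SeatArrangement.Outputs s π ∧
              SeatArrangement.IsMaximum G f π := by
  open SeatArrangement in
  refine ⟨maximumWelfare, 3000 * 28, fun n hn G f γ hγ => ?_⟩
  -- All vertices but one already form a cover. Strictness is essential, since for γ = n ≥ 1 the
  -- claimed bound would be zero.
  have hlt : γ < n := by
    have : Nonempty (Fin n) := ⟨⟨0, hn⟩⟩
    have := G.vertexCoverNum_lt_card
    rw [hγ, ENat.card_eq_coe_fintype_card, Fintype.card_fin] at this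
    exact_mod_cast this
  obtain ⟨X, hXn, hX⟩ := exists_isCoverTuple G hγ
  obtain ⟨t, s, hexec, ht, σ, hσ, hout, hbest⟩ :=
    run_maximumWelfare (s := inputState G f) (adj := natAdj G) (g := natPref f) hn rfl
      (fun x hx => if_neg hx)
      (fun v hv x hx => by
        simp only [inputState, if_true, rowMajor_apply _ hv hx, natAdj, hv, hx, exists_true_left]
        split_ifs with h <;> simp [h])
      (fun q hq r hr => by
        simp only [inputState, if_true, rowMajor_apply _ hq hr, natPref, hq, hr, and_self, dif_pos])
      (fun v x ⟨hv, hx, h⟩ => ⟨hx, hv, h.symm⟩) hlt.le hXn hX (vertexCoverNum_le_card_image G hγ)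
  refine ⟨t, s, arrangementOfPermutes hσ, hexec, ht.trans ?_, fun p => ?_, fun π => ?_⟩
  · rw [mul_assoc]
    exact Nat.mul_le_mul_left _ (time_bound hlt)
  -- The algorithm works with the map from seats to agents, whereas the output array is indexed by
  -- agents; so each agent is written as the occupant of a seat.
  · obtain ⟨v, rfl⟩ := (arrangementOfPermutes hσ).symm.surjective p
    rw [Equiv.apply_symm_apply, arrangementOfPermutes_symm]
    exact hout v v.2
  · rw [socialWelfare_eq_welfare G f _ fun v => (arrangementOfPermutes_symm hσ v).symm,
      socialWelfare_eq_welfare G f π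
        (σ := fun v => if h : v < n then (π.symm ⟨v, h⟩ : ℕ) else v) fun v => by simp]
    exact hbest _ (permutes_of_arrangement π)
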